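/- Let $(\mathfrak g,\bullet)$ be a real left symmetric algebra, i.e. $(u\bullet v)\bullet w-u\bullet(v\bullet w)$ is symmetric in $u,v$, and let $[u,v]=u\bullet v-v\bullet u$. For $r\in\mathfrak g\otimes\mathfrak g$ write $r_\#:\mathfrak g^*\to\mathfrak g$, $\langle\beta,r_\#(\alpha)\rangle=r(\alpha,\beta)$, and $\langle \mathrm L_u^*\alpha,v\rangle=-\langle\alpha,u\bullet v\rangle$. Let $r$ be an S-matrix, i.e. $r$ is symmetric and for all $\alpha,\beta,\gamma\in\mathfrak g^*$ $$\big\langle\gamma,\;r_\#\big(\mathrm L^*_{r_\#(\alpha)}\beta-\mathrm L^*_{r_\#(\beta)}\alpha\big)-[r_\#(\alpha),r_\#(\beta)]\big\rangle=0 .$$ Let $R\in(\mathfrak g\times\mathfrak g)\otimes(\mathfrak g\times\mathfrak g)$ be given by $R((\alpha_1,\beta_1),(\alpha_2,\beta_2))=r(\alpha_1,\beta_2)-r(\alpha_2,\beta_1)$. Let $(M,\nabla)$ be an affine manifold, i.e. a smooth (Hausdorff, finite-dimensional) manifold $M$ with a smooth connection $\nabla$ on $TM$ with vanishing torsion and curvature;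 let $p:TM\to M$ be the projection, and denote by $X^h$ and $X^v$ the horizontal (with respect to $\nabla$) and vertical lifts to $TM$ of a vector field $X$ on $M$. For a one-form $\alpha$ on $M$ let $\alpha^h,\alpha^v$ be the one-forms on $TM$ with $\alpha^h(X^h)=\alpha^v(X^v)=\alpha(X)\circ p$ and $\alpha^h(X^v)=\alpha^v(X^h)=0$. The bivector field associated to a symmetric bivector field $h$ on $M$ is the bivector field $\Pi$ on $TM$ determined by $$\Pi(\alpha^v,\beta^v)=\Pi(\alpha^h,\beta^h)=0,\qquad \Pi(\alpha^h,\beta^v)=-\Pi(\beta^v,\alpha^h)=h(\alpha,\beta)\circ p .$$ Let $\rho:\mathfrak g\to\Gamma(TM)$ be a linear map into the smooth vector fields such that $\rho(u\bullet v)=\nabla_{\rho(u)}\rho(v)$ for all $u,v\in\mathfrak g$, and let $\rho^l:\mathfrak g\times\mathfrak g\to\Gamma(TTM)$, $\rho^l(u,v)=\rho(u)^h+\rho(v)^v$. Let $\rho(r)$ and $\rho^l(R)$ be the images of $r$ and $R$ under $\rho\otimes\rho$ and $\rho^l\otimes\rho^l$; they are fields of two-tensors on $M$ and on $TM$. Theorem.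 The bivector field on $TM$ associated to $\rho(r)$ is $\rho^l(R)$. It is a Poisson tensor, i.e. it is smooth, skew-symmetric, and the bracket $\{f,g\}=\rho^l(R)(df,dg)$ on $C^\infty(TM)$ satisfies the Jacobi identity. Moreover $(M,\nabla,\rho(r))$ is a contravariant pseudo-Hessian manifold, i.e. $(M,\nabla)$ is affine and $h=\rho(r)$ is a smooth symmetric bivector field with $$(\nabla_{h_\#(\alpha)}h)(\beta,\gamma)=(\nabla_{h_\#(\beta)}h)(\alpha,\gamma)\qquad\text{for all }\alpha,\beta,\gamma\in\Omega^1(M),$$ where $\gamma(h_\#(\alpha))=h(\alpha,\gamma)$. -/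

import Mathlib

open scoped Manifold ContDiff TensorProduct

noncomputable section

set_option linter.unusedSectionVars false

/-! ### Contravariant two-tensors on a real vector space -/

section Algebra

variable {V W : Type*} [AddCommGroup V] [Module ℝ V] [AddCommGroup W] [Module ℝ W]

/-- The value `t(α, β)` of `t ∈ V ⊗ V` on two covectors: `(u ⊗ v)(α, β) = α(u) β(v)`. -/
def tensorEval (t : V ⊗[ℝ] V) (α β : V →ₗ[ℝ] ℝ) : ℝ :=
  TensorProduct.lid ℝ ℝ (TensorProduct.map α β t)

/-- The contraction `t_# : V* → V`, characterized by `β(t_#(α)) = t(α, β)`. -/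
def tensorSharp (t : V ⊗[ℝ] V) (α : V →ₗ[ℝ] ℝ) : V :=
  TensorProduct.lid ℝ V (TensorProduct.map α LinearMap.id t)

theorem apply_tensorSharp (t : V ⊗[ℝ] V) (α β : V →ₗ[ℝ] ℝ) :
    β (tensorSharp t α) = tensorEval t α β := by
  induction t with
  | zero => simp [tensorSharp, tensorEval]
  | tmul u v => simp [tensorSharp, tensorEval]
  | add s t hs ht => simp_all [tensorSharp, tensorEval]

/-- For `r ∈ V ⊗ V`, the two-tensor `R ∈ (V × V) ⊗ (V × V)` given by
`R((α₁, β₁), (α₂, β₂)) = r(α₁, β₂) - r(α₂, β₁)`. -/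
def doubleTensor (r : V ⊗[ℝ] V) : (V × V) ⊗[ℝ] (V × V) :=
  TensorProduct.map (LinearMap.inl ℝ V V) (LinearMap.inr ℝ V V) r -
    TensorProduct.comm ℝ (V × V) (V × V)
      (TensorProduct.map (LinearMap.inl ℝ V V) (LinearMap.inr ℝ V V) r)

theorem tensorEval_doubleTensor (r : V ⊗[ℝ] V) (α₁ β₁ α₂ β₂ : V →ₗ[ℝ] ℝ) :
    tensorEval (doubleTensor r) (α₁.coprod β₁) (α₂.coprod β₂) =
      tensorEval r α₁ β₂ - tensorEval r α₂ β₁ := by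
  induction r with
  | zero => simp [doubleTensor, tensorEval]
  | tmul u v => simp [doubleTensor, tensorEval, mul_comm]
  | add s t hs ht =>
    simp only [doubleTensor, tensorEval, map_add, map_sub] at *
    linarith

end Algebra

/-! ### S-matrices on a left symmetric algebra -/

section SMatrix

variable {𝔤 : Type*} [LeftPreLieRing 𝔤] [LeftPreLieAlgebra ℝ 𝔤]

/-- `L*_u α`, where `⟨L*_u α, v⟩ = -⟨α, u • v⟩`. -/
def coLeftMul (u : 𝔤) (α : 𝔤 →ₗ[ℝ] ℝ) : 𝔤 →ₗ[ℝ] ℝ :=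
  -(α ∘ₗ LinearMap.mulLeft ℝ u)

/-- `[α, β]_r = L*_{r_#(α)} β - L*_{r_#(β)} α`. -/
def dualBracket (r : 𝔤 ⊗[ℝ] 𝔤) (α β : 𝔤 →ₗ[ℝ] ℝ) : 𝔤 →ₗ[ℝ] ℝ :=
  coLeftMul (tensorSharp r α) β - coLeftMul (tensorSharp r β) α

/-- `[[r, r]](α, β, γ) = ⟨γ, r_#([α, β]_r) - [r_#(α), r_#(β)]⟩`, where `[u, v] = u • v - v • u`. -/
def sBracket (r : 𝔤 ⊗[ℝ] 𝔤) (α β γ : 𝔤 →ₗ[ℝ] ℝ) : ℝ :=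
  γ (tensorSharp r (dualBracket r α β) -
    (tensorSharp r α * tensorSharp r β - tensorSharp r β * tensorSharp r α))

/-- An S-matrix: a symmetric `r ∈ 𝔤 ⊗ 𝔤` with `[[r, r]] = 0`. -/
structure IsSMatrix (r : 𝔤 ⊗[ℝ] 𝔤) : Prop where
  symm : TensorProduct.comm ℝ 𝔤 𝔤 r = r
  bracket_eq_zero : ∀ α β γ : 𝔤 →ₗ[ℝ] ℝ, sBracket r α β γ = 0

end SMatrix

/-! ### Fields of contravariant two-tensors on a manifold, and Poisson tensors -/

section Manifold

variable {F : Type*} [NormedAddCommGroup F] [NormedSpace ℝ F]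
  {K : Type*} [TopologicalSpace K] (J : ModelWithCorners ℝ F K)
  (N : Type*) [TopologicalSpace N] [ChartedSpace K N]

/-- A (not necessarily smooth) field of two-tensors, i.e. a section of `TN ⊗ TN`. -/
abbrev TwoTensorField : Type _ := ∀ x : N, TangentSpace J x ⊗[ℝ] TangentSpace J x

variable [IsManifold J ∞ N]

/-- Smooth vector fields. -/
abbrev SmoothVectorField : Type _ :=
  ContMDiffSection J F ∞ (fun x : N ↦ TangentSpace J x)

/-- Smooth differential one-forms. -/
abbrev SmoothOneForm : Type _ :=
  ContMDiffSection J (F →L[ℝ] ℝ) ∞ (fun x : N ↦ TangentSpace J x →L[ℝ] ℝ)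

variable {J N}

/-- A field of two-tensors `h` is smooth if `h(α, β)` is a smooth function for all smooth
one-forms `α`, `β`. -/
def TwoTensorField.IsSmooth (h : TwoTensorField J N) : Prop :=
  ∀ α β : SmoothOneForm J N,
    ContMDiff J 𝓘(ℝ, ℝ) ∞ (fun x ↦ tensorEval (h x) (α x).toLinearMap (β x).toLinearMap)

/-- The bracket `{f, g} = P(df, dg)`. -/
def TwoTensorField.bracket (P : TwoTensorField J N) (f g : N → ℝ) (x : N) : ℝ :=
  tensorEval (P x) (mvfderiv J f x).toLinearMap (mvfderiv J g x).toLinearMap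

/-- A Poisson tensor: a smooth skew-symmetric bivector field whose bracket `{f, g} = P(df, dg)`
on smooth functions satisfies the Jacobi identity. -/
structure IsPoissonTensor (P : TwoTensorField J N) : Prop where
  smooth : P.IsSmooth
  skew : ∀ x, TensorProduct.comm ℝ _ _ (P x) = -P x
  jacobi : ∀ f g k : N → ℝ, ContMDiff J 𝓘(ℝ, ℝ) ∞ f → ContMDiff J 𝓘(ℝ, ℝ) ∞ g →
    ContMDiff J 𝓘(ℝ, ℝ) ∞ k → ∀ x,
      P.bracket f (P.bracket g k) x + P.bracket g (P.bracket k f) x +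
        P.bracket k (P.bracket f g) x = 0

end Manifold

/-! ### Affine manifolds and contravariant pseudo-Hessian structures -/

section Affine

variable {E : Type*} [NormedAddCommGroup E] [NormedSpace ℝ E]
  {M : Type*} [TopologicalSpace M] [ChartedSpace E M] [IsManifold 𝓘(ℝ, E) ∞ M]

/-- `nabla` is smooth, torsionless and has vanishing curvature, i.e. `(M, nabla)` is an affine
manifold.  Here `∇_X Y` at `x` is `nabla Y x (X x)`. -/
structure IsFlatConnection
    (nabla : CovariantDerivative 𝓘(ℝ, E) E (fun x : M ↦ TangentSpace 𝓘(ℝ, E) x)) : Prop where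
  smooth : nabla.ContMDiffCovariantDerivative ∞
  torsion_eq_zero : ∀ (X Y : SmoothVectorField 𝓘(ℝ, E) M) (x : M),
    nabla Y x (X x) - nabla X x (Y x) = VectorField.mlieBracket 𝓘(ℝ, E) X Y x
  curvature_eq_zero : ∀ (X Y Z : SmoothVectorField 𝓘(ℝ, E) M) (x : M),
    nabla (fun y ↦ nabla Z y (Y y)) x (X x) - nabla (fun y ↦ nabla Z y (X y)) x (Y x) -
      nabla Z x (VectorField.mlieBracket 𝓘(ℝ, E) X Y x) = 0

variable [FiniteDimensional ℝ E]
  (nabla : CovariantDerivative 𝓘(ℝ, E) E (fun x : M ↦ TangentSpace 𝓘(ℝ, E) x))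

theorem SmoothOneForm.mdifferentiableAt_apply (β : SmoothOneForm 𝓘(ℝ, E) M) {x : M}
    {Y : ∀ y : M, TangentSpace 𝓘(ℝ, E) y}
    (hY : MDifferentiableAt 𝓘(ℝ, E) 𝓘(ℝ, E).tangent
      (fun y ↦ (⟨y, Y y⟩ : TangentBundle 𝓘(ℝ, E) M)) x) :
    MDifferentiableAt 𝓘(ℝ, E) 𝓘(ℝ, ℝ) (fun y ↦ β y (Y y)) x := by
  have h := MDifferentiableAt.clm_bundle_apply (E₂ := Bundle.Trivial M ℝ)
    ((β.contMDiff x).mdifferentiableAt (by simp)) hY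
  exact (mdifferentiableAt_section _ _).1 h

theorem tensorialAt_covDerivOneForm (β : SmoothOneForm 𝓘(ℝ, E) M) (x : M)
    (v : TangentSpace 𝓘(ℝ, E) x) :
    TensorialAt 𝓘(ℝ, E) E
      (fun Y : (∀ y : M, TangentSpace 𝓘(ℝ, E) y) ↦
        mvfderiv 𝓘(ℝ, E) (fun y ↦ β y (Y y)) x v - β x (nabla Y x v)) x where
  smul {f Y} hf hY := by
    have h : (fun y ↦ β y ((f • Y) y)) = f * fun y ↦ β y (Y y) := by
      ext y; simp
    simp only [h, mvfderiv_mul hf (β.mdifferentiableAt_apply hY),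
      nabla.isCovariantDerivativeOnUniv.leibniz hY hf]
    simp
    ring
  add {Y Z} hY hZ := by
    have h : (fun y ↦ β y ((Y + Z) y)) = (fun y ↦ β y (Y y)) + fun y ↦ β y (Z y) := by
      ext y; simp
    simp only [h, mvfderiv_add (β.mdifferentiableAt_apply hY) (β.mdifferentiableAt_apply hZ),
      nabla.isCovariantDerivativeOnUniv.add hY hZ]
    simp
    ring

/-- The covariant derivative `∇_v β` of a one-form: `(∇_X β)(Y) = X(β(Y)) - β(∇_X Y)`. -/
def covDerivOneForm (β : SmoothOneForm 𝓘(ℝ, E) M) (x : M) (v : TangentSpace 𝓘(ℝ, E) x) :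
    TangentSpace 𝓘(ℝ, E) x →L[ℝ] ℝ :=
  TensorialAt.mkHom _ x (tensorialAt_covDerivOneForm nabla β x v)

/-- The covariant derivative of a field of two-tensors:
`(∇_X h)(β, γ) = X(h(β, γ)) - h(∇_X β, γ) - h(β, ∇_X γ)`. -/
def covDerivTwoTensor (h : TwoTensorField 𝓘(ℝ, E) M) (x : M) (v : TangentSpace 𝓘(ℝ, E) x)
    (β γ : SmoothOneForm 𝓘(ℝ, E) M) : ℝ :=
  mvfderiv 𝓘(ℝ, E) (fun y ↦ tensorEval (h y) (β y).toLinearMap (γ y).toLinearMap) x v -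
    tensorEval (h x) (covDerivOneForm nabla β x v).toLinearMap (γ x).toLinearMap -
    tensorEval (h x) (β x).toLinearMap (covDerivOneForm nabla γ x v).toLinearMap

/-- `(M, nabla, h)` is a contravariant pseudo-Hessian manifold: `nabla` is flat, and `h` is a smooth
symmetric bivector field with `(∇_{h_#(α)} h)(β, γ) = (∇_{h_#(β)} h)(α, γ)` for all one-forms. -/
structure IsContravariantPseudoHessian (h : TwoTensorField 𝓘(ℝ, E) M) : Prop where
  flat : IsFlatConnection nabla
  smooth : h.IsSmooth
  symm : ∀ x, TensorProduct.comm ℝ _ _ (h x) = h x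
  codazzi : ∀ (α β γ : SmoothOneForm 𝓘(ℝ, E) M) (x : M),
    covDerivTwoTensor nabla h x (tensorSharp (h x) (α x).toLinearMap) β γ =
      covDerivTwoTensor nabla h x (tensorSharp (h x) (β x).toLinearMap) α γ

/-! ### Lifts to the tangent bundle -/

/-- The derivative at `u` of the inclusion `w ↦ (x, w)` of the fibre `T_x M = E` in `TM`. -/
def fibreInclusionDeriv (x : M) (u : E) : TangentSpace 𝓘(ℝ, E) x →L[ℝ]
    TangentSpace 𝓘(ℝ, E).tangent (⟨x, u⟩ : TangentBundle 𝓘(ℝ, E) M) :=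
  mfderiv 𝓘(ℝ, E) 𝓘(ℝ, E).tangent (fun w : E ↦ (⟨x, w⟩ : TangentBundle 𝓘(ℝ, E) M)) u

/-- The vertical lift at `p = (x, u)` of `w ∈ T_x M`, i.e. the velocity at `t = 0` of the curve
`t ↦ (x, u + t w)`. -/
def verticalLift (p : TangentBundle 𝓘(ℝ, E) M) :
    TangentSpace 𝓘(ℝ, E) p.proj →ₗ[ℝ] TangentSpace 𝓘(ℝ, E).tangent p :=
  (fibreInclusionDeriv (E := E) p.proj p.snd).toLinearMap

/-- The derivative at `x` of a vector field `Y`, seen as a map `Y : M → TM`. -/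
def vectorFieldDeriv (Y : ∀ y : M, TangentSpace 𝓘(ℝ, E) y) (x : M) :
    TangentSpace 𝓘(ℝ, E) x →L[ℝ]
      TangentSpace 𝓘(ℝ, E).tangent (⟨x, Y x⟩ : TangentBundle 𝓘(ℝ, E) M) :=
  mfderiv 𝓘(ℝ, E) 𝓘(ℝ, E).tangent (fun y ↦ (⟨y, Y y⟩ : TangentBundle 𝓘(ℝ, E) M)) x

/-- The derivative at `x` of a local vector field `Y : M → TM` with `Y(x) = u`, where
`p = (x, u)`. -/
def extendDeriv (p : TangentBundle 𝓘(ℝ, E) M) :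
    TangentSpace 𝓘(ℝ, E) p.proj →ₗ[ℝ] TangentSpace 𝓘(ℝ, E).tangent p :=
  (vectorFieldDeriv (FiberBundle.extend E p.snd) p.proj).toLinearMap

/-- The horizontal lift at `p = (x, u)` of `v ∈ T_x M`: it is `dY(v) - (∇_v Y)^v`, where `Y` is
a local vector field with `Y(x) = u`. -/
def horizontalLift (p : TangentBundle 𝓘(ℝ, E) M) :
    TangentSpace 𝓘(ℝ, E) p.proj →ₗ[ℝ] TangentSpace 𝓘(ℝ, E).tangent p :=
  extendDeriv p - verticalLift p ∘ₗ (nabla (FiberBundle.extend E p.snd) p.proj).toLinearMap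

/-- The trivialization of `TM` at `x`, on the fibre over `x`. -/
def fibreCoord (x : M) : E ≃L[ℝ] E :=
  (trivializationAt E (fun y : M ↦ TangentSpace 𝓘(ℝ, E) y) x).continuousLinearEquivAt ℝ x
    (FiberBundle.mem_baseSet_trivializationAt' x)

theorem mdifferentiableAt_fibreInclusion (x : M) (u : E) :
    MDifferentiableAt 𝓘(ℝ, E) 𝓘(ℝ, E).tangent
      (fun w : E ↦ (⟨x, w⟩ : TangentBundle 𝓘(ℝ, E) M)) u := by
  rw [mdifferentiableAt_totalSpace]
  refine ⟨mdifferentiableAt_const, ?_⟩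
  exact (fibreCoord (E := E) x).toContinuousLinearMap.mdifferentiableAt

theorem mfderiv_proj_fibreInclusionDeriv (x : M) (u : E) (w : TangentSpace 𝓘(ℝ, E) x) :
    mfderiv 𝓘(ℝ, E).tangent 𝓘(ℝ, E) (fun q : TangentBundle 𝓘(ℝ, E) M ↦ q.proj) ⟨x, u⟩
      (fibreInclusionDeriv x u w) = 0 := by
  have h := mfderiv_comp_apply (I := 𝓘(ℝ, E)) (I' := 𝓘(ℝ, E).tangent) (I'' := 𝓘(ℝ, E))
    (f := fun w : E ↦ (⟨x, w⟩ : TangentBundle 𝓘(ℝ, E) M))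
    (g := fun q : TangentBundle 𝓘(ℝ, E) M ↦ q.proj) u
    (Bundle.mdifferentiableAt_proj _) (mdifferentiableAt_fibreInclusion x u) w
  have h2 : ((fun q : TangentBundle 𝓘(ℝ, E) M ↦ q.proj) ∘
      fun w : E ↦ (⟨x, w⟩ : TangentBundle 𝓘(ℝ, E) M)) = fun _ ↦ x := rfl
  rw [h2, mfderiv_const] at h
  exact h.symm

theorem mfderiv_proj_verticalLift (p : TangentBundle 𝓘(ℝ, E) M)
    (w : TangentSpace 𝓘(ℝ, E) p.proj) :
    mfderiv 𝓘(ℝ, E).tangent 𝓘(ℝ, E) (fun q : TangentBundle 𝓘(ℝ, E) M ↦ q.proj) p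
      (verticalLift p w) = 0 :=
  mfderiv_proj_fibreInclusionDeriv (E := E) p.proj p.snd w

theorem mfderiv_proj_horizontalLift (p : TangentBundle 𝓘(ℝ, E) M)
    (v : TangentSpace 𝓘(ℝ, E) p.proj) :
    mfderiv 𝓘(ℝ, E).tangent 𝓘(ℝ, E) (fun q : TangentBundle 𝓘(ℝ, E) M ↦ q.proj) p
      (horizontalLift nabla p v) = v := by
  rw [horizontalLift, LinearMap.sub_apply, map_sub, LinearMap.comp_apply,
    mfderiv_proj_verticalLift, sub_zero]
  obtain ⟨x, u⟩ := p
  have h := mfderiv_comp_apply (I := 𝓘(ℝ, E)) (I' := 𝓘(ℝ, E).tangent) (I'' := 𝓘(ℝ, E))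
    (f := fun y : M ↦ (⟨y, FiberBundle.extend E u y⟩ : TangentBundle 𝓘(ℝ, E) M))
    (g := fun q : TangentBundle 𝓘(ℝ, E) M ↦ q.proj) (x := x)
    (Bundle.mdifferentiableAt_proj _) (FiberBundle.mdifferentiableAt_extend _ _ u) v
  have h2 : ((fun q : TangentBundle 𝓘(ℝ, E) M ↦ q.proj) ∘
      fun y : M ↦ (⟨y, FiberBundle.extend E u y⟩ : TangentBundle 𝓘(ℝ, E) M)) = id := rfl
  rw [h2, mfderiv_id] at h
  have h3 : (⟨x, FiberBundle.extend E u x⟩ : TangentBundle 𝓘(ℝ, E) M) = ⟨x, u⟩ := by simp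
  rw [h3] at h
  exact h.symm

theorem fibreInclusionDeriv_injective (x : M) (u : E) :
    Function.Injective (fibreInclusionDeriv x u) := by
  let G : TangentBundle 𝓘(ℝ, E) M → E :=
    fun q ↦ (trivializationAt E (fun y : M ↦ TangentSpace 𝓘(ℝ, E) y) x q).2
  have hG : MDifferentiableAt 𝓘(ℝ, E).tangent 𝓘(ℝ, E) G ⟨x, u⟩ := by
    have h : MDifferentiableAt 𝓘(ℝ, E).tangent 𝓘(ℝ, E).tangent
      (fun q : TangentBundle 𝓘(ℝ, E) M ↦ q) ⟨x, u⟩ := mdifferentiableAt_id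
    rw [mdifferentiableAt_totalSpace] at h
    exact h.2
  have hcomp := mfderiv_comp (I := 𝓘(ℝ, E)) (I' := 𝓘(ℝ, E).tangent) (I'' := 𝓘(ℝ, E))
    (f := fun w : E ↦ (⟨x, w⟩ : TangentBundle 𝓘(ℝ, E) M))
    (g := G) u hG (mdifferentiableAt_fibreInclusion x u)
  have h2 : (G ∘ fun w : E ↦ (⟨x, w⟩ : TangentBundle 𝓘(ℝ, E) M)) =
    fun w ↦ (fibreCoord (E := E) x).toContinuousLinearMap w := rfl
  rw [h2, ContinuousLinearMap.mfderiv_eq] at hcomp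
  intro w w' hw
  apply (fibreCoord (E := E) x).injective
  have e1 := congrArg (fun L ↦ L w) hcomp
  have e2 := congrArg (fun L ↦ L w') hcomp
  have e3 := congrArg (mfderiv 𝓘(ℝ, E).tangent 𝓘(ℝ, E) G ⟨x, u⟩) hw
  exact e1.trans (Eq.trans e3 e2.symm)

theorem verticalLift_injective (p : TangentBundle 𝓘(ℝ, E) M) :
    Function.Injective (verticalLift p) :=
  fibreInclusionDeriv_injective (E := E) p.proj p.snd

theorem lifts_bijective (p : TangentBundle 𝓘(ℝ, E) M) :
    Function.Bijective ((horizontalLift nabla p).coprod (verticalLift p)) := by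
  have hinj : Function.Injective ((horizontalLift nabla p).coprod (verticalLift p)) := by
    rw [injective_iff_map_eq_zero]
    rintro ⟨a, b⟩ hab
    simp only [LinearMap.coprod_apply] at hab
    have ha : a = 0 := by
      have := congrArg (mfderiv 𝓘(ℝ, E).tangent 𝓘(ℝ, E)
        (fun q : TangentBundle 𝓘(ℝ, E) M ↦ q.proj) p) hab
      rw [map_add, mfderiv_proj_horizontalLift, mfderiv_proj_verticalLift] at this
      simpa using this
    subst ha
    have hb : b = 0 := verticalLift_injective p (by simpa using hab)
    simp [hb]
  have : FiniteDimensional ℝ (TangentSpace 𝓘(ℝ, E) p.proj) :=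
    inferInstanceAs (FiniteDimensional ℝ E)
  have : FiniteDimensional ℝ (TangentSpace 𝓘(ℝ, E).tangent p) :=
    inferInstanceAs (FiniteDimensional ℝ (E × E))
  exact ⟨hinj, (LinearMap.injective_iff_surjective_of_finrank_eq_finrank rfl).1 hinj⟩

/-- The splitting `T_x M × T_x M ≃ T_p TM`, `(a, b) ↦ a^h + b^v`, at `p = (x, u)`. -/
def splitting (p : TangentBundle 𝓘(ℝ, E) M) :
    (TangentSpace 𝓘(ℝ, E) p.proj × TangentSpace 𝓘(ℝ, E) p.proj) ≃ₗ[ℝ]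
      TangentSpace 𝓘(ℝ, E).tangent p :=
  LinearEquiv.ofBijective _ (lifts_bijective nabla p)

/-- `α^v` at `p`: the covector on `T_p TM` with `α^v(X^v) = α(X)` and `α^v(X^h) = 0`. -/
def verticalLiftForm (p : TangentBundle 𝓘(ℝ, E) M) (α : TangentSpace 𝓘(ℝ, E) p.proj →ₗ[ℝ] ℝ) :
    TangentSpace 𝓘(ℝ, E).tangent p →ₗ[ℝ] ℝ :=
  α ∘ₗ LinearMap.snd ℝ _ _ ∘ₗ (splitting nabla p).symm.toLinearMap

/-- `α^h` at `p`: the covector on `T_p TM` with `α^h(X^h) = α(X)` and `α^h(X^v) = 0`. -/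
def horizontalLiftForm (p : TangentBundle 𝓘(ℝ, E) M) (α : TangentSpace 𝓘(ℝ, E) p.proj →ₗ[ℝ] ℝ) :
    TangentSpace 𝓘(ℝ, E).tangent p →ₗ[ℝ] ℝ :=
  α ∘ₗ LinearMap.fst ℝ _ _ ∘ₗ (splitting nabla p).symm.toLinearMap

theorem splitting_symm_horizontalLift (p : TangentBundle 𝓘(ℝ, E) M)
    (v : TangentSpace 𝓘(ℝ, E) p.proj) :
    (splitting nabla p).symm (horizontalLift nabla p v) = (v, 0) := by
  rw [LinearEquiv.symm_apply_eq]
  simp [splitting]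

theorem splitting_symm_verticalLift (p : TangentBundle 𝓘(ℝ, E) M)
    (w : TangentSpace 𝓘(ℝ, E) p.proj) :
    (splitting nabla p).symm (verticalLift p w) = (0, w) := by
  rw [LinearEquiv.symm_apply_eq]
  simp [splitting]

theorem verticalLiftForm_apply (p : TangentBundle 𝓘(ℝ, E) M)
    (α : TangentSpace 𝓘(ℝ, E) p.proj →ₗ[ℝ] ℝ) (v : TangentSpace 𝓘(ℝ, E) p.proj) :
    verticalLiftForm nabla p α (verticalLift p v) = α v ∧
      verticalLiftForm nabla p α (horizontalLift nabla p v) = 0 := by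
  simp [verticalLiftForm, splitting_symm_horizontalLift, splitting_symm_verticalLift]

theorem horizontalLiftForm_apply (p : TangentBundle 𝓘(ℝ, E) M)
    (α : TangentSpace 𝓘(ℝ, E) p.proj →ₗ[ℝ] ℝ) (v : TangentSpace 𝓘(ℝ, E) p.proj) :
    horizontalLiftForm nabla p α (horizontalLift nabla p v) = α v ∧
      horizontalLiftForm nabla p α (verticalLift p v) = 0 := by
  simp [horizontalLiftForm, splitting_symm_horizontalLift, splitting_symm_verticalLift]

/-- `P` is the bivector field on `TM` associated to the symmetric bivector field `h` on `M`:
`P(α^v, β^v) = P(α^h, β^h) = 0` and `P(α^h, β^v) = -P(β^v, α^h) = h(α, β) ∘ p`. -/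
def IsAssociatedBivector (h : TwoTensorField 𝓘(ℝ, E) M)
    (P : TwoTensorField 𝓘(ℝ, E).tangent (TangentBundle 𝓘(ℝ, E) M)) : Prop :=
  ∀ (p : TangentBundle 𝓘(ℝ, E) M) (α β : TangentSpace 𝓘(ℝ, E) p.proj →ₗ[ℝ] ℝ),
    tensorEval (P p) (verticalLiftForm nabla p α) (verticalLiftForm nabla p β) = 0 ∧
    tensorEval (P p) (horizontalLiftForm nabla p α) (horizontalLiftForm nabla p β) = 0 ∧
    tensorEval (P p) (horizontalLiftForm nabla p α) (verticalLiftForm nabla p β) =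
      tensorEval (h p.proj) α β ∧
    -tensorEval (P p) (verticalLiftForm nabla p β) (horizontalLiftForm nabla p α) =
      tensorEval (h p.proj) α β

/-! ### Images of tensors under a linear map `ρ : 𝔤 → Γ(TM)` -/

section Action

variable {𝔤 : Type*} [AddCommGroup 𝔤] [Module ℝ 𝔤] (ρ : 𝔤 →ₗ[ℝ] SmoothVectorField 𝓘(ℝ, E) M)

/-- `u ↦ ρ(u)(x)`. -/
def evalAt (x : M) : 𝔤 →ₗ[ℝ] TangentSpace 𝓘(ℝ, E) x where
  toFun u := ρ u x
  map_add' u v := by simp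
  map_smul' c u := by simp

/-- The bivector field `ρ(r)` on `M`: `ρ(u ⊗ v) = ρ(u) ⊗ ρ(v)`. -/
def pushTensor (r : 𝔤 ⊗[ℝ] 𝔤) : TwoTensorField 𝓘(ℝ, E) M :=
  fun x ↦ TensorProduct.map (evalAt ρ x) (evalAt ρ x) r

/-- `ρ^l(u, v) = ρ(u)^h + ρ(v)^v`, at `p`. -/
def liftAt (p : TangentBundle 𝓘(ℝ, E) M) : 𝔤 × 𝔤 →ₗ[ℝ] TangentSpace 𝓘(ℝ, E).tangent p :=
  (horizontalLift nabla p ∘ₗ evalAt ρ p.proj).coprod (verticalLift p ∘ₗ evalAt ρ p.proj)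

/-- The bivector field `ρ^l(R)` on `TM`: `ρ^l(a ⊗ b) = ρ^l(a) ⊗ ρ^l(b)`. -/
def pushLiftTensor (R : (𝔤 × 𝔤) ⊗[ℝ] (𝔤 × 𝔤)) :
    TwoTensorField 𝓘(ℝ, E).tangent (TangentBundle 𝓘(ℝ, E) M) :=
  fun p ↦ TensorProduct.map (liftAt nabla ρ p) (liftAt nabla ρ p) R

end Action

end Affine

end

/-! All three claims become algebra in `𝔤` once the commutators of the lifts are known. In the chart
of `TM` at `p` the horizontal lift of `v` at `(x, u)` is `(v, -Γ(v)u)` and the vertical lift of `w`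
is `(0, w)`, with `Γ` the connection form. Hence `[X^h, Y^h] = [X, Y]^h`, which is the vanishing of
the curvature, `[X^h, Y^v] = (∇_X Y)^v` and `[X^v, Y^v] = 0`. For `X = ρ(x)`, `Y = ρ(y)`, since the
torsion vanishes and `ρ(x • y) = ∇_{ρ(x)} ρ(y)`, these read `[h x, h y] = h [x, y]`, `[h x, v y] = v
(x • y)`, `[v x, v y] = 0`.

Poisson: for `r = ∑ xᵢ ⊗ yᵢ` the bracket is `{F, G} = ∑ (h xᵢ F)(v yᵢ G) - (v yᵢ F)(h xᵢ G)`. In the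
cyclic sum of `{F, {G, K}}` the second derivatives of each function occur only in commutators
(`LiftJet.secondOrderPart_sub`). The remaining first-order terms, grouped by the function that is
differentiated horizontally, are up to sign three instances of `[[r, r]] = 0`
(`IsSMatrix.sum_eq_zero`, `LiftJet.jacobi`).

Pseudo-Hessian: `∇_{ρ(w)} ρ(r)` is, up to sign, `r` with `L*_w` inserted in each slot
(`covDerivTwoTensor_pushTensor`). The vectors `h_#(α)` are values of fields `ρ(w)` with `w = r_#(α ∘
ρ)`, so the Codazzi equation is `[[r, r]] = 0` rewritten (`IsSMatrix.tensorEval_eq`).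

Association: `R` pairs the horizontal factor with the vertical one by `r`, which gives the
prescribed values on lifted covectors. Uniqueness holds because every covector on `TM` is a sum of a
horizontal and a vertical lift. -/

noncomputable section

set_option linter.unusedSectionVars false

/-! ### Two-tensors: naturality, finite sums of pure tensors, separation by covectors -/

section TensorSums

variable {V W : Type*} [AddCommGroup V] [Module ℝ V] [AddCommGroup W] [Module ℝ W]
  {ι : Type*} (s : Finset ι) (u v : ι → V)

theorem tensorEval_sum_tmul (α β : V →ₗ[ℝ] ℝ) :
    tensorEval (∑ i ∈ s, u i ⊗ₜ[ℝ] v i) α β = ∑ i ∈ s, α (u i) * β (v i) := by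
  simp [tensorEval]

theorem tensorSharp_sum_tmul (α : V →ₗ[ℝ] ℝ) :
    tensorSharp (∑ i ∈ s, u i ⊗ₜ[ℝ] v i) α = ∑ i ∈ s, α (u i) • v i := by
  simp [tensorSharp]

theorem tensorEval_map (f : V →ₗ[ℝ] W) (t : V ⊗[ℝ] V) (α β : W →ₗ[ℝ] ℝ) :
    tensorEval (TensorProduct.map f f t) α β = tensorEval t (α ∘ₗ f) (β ∘ₗ f) := by
  induction t with
  | zero => simp [tensorEval]
  | tmul u v => simp [tensorEval]
  | add s t hs ht => simp_all [tensorEval]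

/-- Naturality of the contraction. It shows that `h_#(α)` for `h = ρ(r)` is the value of a single
field `ρ(w)`, so only derivatives along such fields are needed. -/
theorem tensorSharp_map (f : V →ₗ[ℝ] W) (t : V ⊗[ℝ] V) (α : W →ₗ[ℝ] ℝ) :
    tensorSharp (TensorProduct.map f f t) α = f (tensorSharp t (α ∘ₗ f)) := by
  induction t with
  | zero => simp [tensorSharp]
  | tmul u v => simp [tensorSharp]
  | add s t hs ht => simp_all [tensorSharp]

theorem tensorEval_comm (t : V ⊗[ℝ] V) (α β : V →ₗ[ℝ] ℝ) :
    tensorEval (TensorProduct.comm ℝ V V t) α β = tensorEval t β α := by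
  induction t with
  | zero => simp [tensorEval]
  | tmul u v => simp [tensorEval, mul_comm]
  | add s t hs ht => simp_all [tensorEval]

theorem comm_map (f : V →ₗ[ℝ] W) (t : V ⊗[ℝ] V) :
    TensorProduct.comm ℝ W W (TensorProduct.map f f t) =
      TensorProduct.map f f (TensorProduct.comm ℝ V V t) := by
  induction t with
  | zero => simp
  | tmul u v => simp
  | add s t hs ht => simp_all

theorem comm_doubleTensor (r : V ⊗[ℝ] V) :
    TensorProduct.comm ℝ (V × V) (V × V) (doubleTensor r) = -doubleTensor r := by
  rw [doubleTensor, map_sub, TensorProduct.comm_comm, neg_sub]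

/-- Two-tensors on a finite-dimensional space are determined by their values on covectors. -/
theorem tensorEval_ext [FiniteDimensional ℝ V] {t t' : V ⊗[ℝ] V}
    (h : ∀ α β : V →ₗ[ℝ] ℝ, tensorEval t α β = tensorEval t' α β) : t = t' := by
  let b := Module.finBasis ℝ V
  refine (b.tensorProduct b).ext_elem fun ⟨i, j⟩ ↦ ?_
  have key (t : V ⊗[ℝ] V) : (b.tensorProduct b).repr t (i, j) =
      tensorEval t (b.coord i) (b.coord j) := by
    induction t with
    | zero => simp [tensorEval]
    | tmul u v => simp [tensorEval, Module.Basis.tensorProduct_repr_tmul_apply, mul_comm]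
    | add s t hs ht => simp_all [tensorEval]
  rw [key, key, h]

theorem exists_sum_tmul (t : V ⊗[ℝ] V) :
    ∃ s : Finset (V × V), t = ∑ i ∈ s, i.1 ⊗ₜ[ℝ] i.2 :=
  TensorProduct.exists_finset t

end TensorSums

/-! ### The S-matrix equation in the two forms used later -/

section SMatrixSums

variable {𝔤 : Type*} [LeftPreLieRing 𝔤] [LeftPreLieAlgebra ℝ 𝔤]

theorem tensorEval_coLeftMul (r : 𝔤 ⊗[ℝ] 𝔤) (w : 𝔤) (β γ : 𝔤 →ₗ[ℝ] ℝ) :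
    tensorEval r β (coLeftMul w γ) = -γ (w * tensorSharp r β) := by
  rw [← apply_tensorSharp]
  simp [coLeftMul]

theorem IsSMatrix.tensorEval_symm {r : 𝔤 ⊗[ℝ] 𝔤} (hr : IsSMatrix r) (α β : 𝔤 →ₗ[ℝ] ℝ) :
    tensorEval r α β = tensorEval r β α := by
  conv_lhs => rw [← hr.symm, tensorEval_comm]

/-- The algebraic Codazzi equation. The second terms on the two sides are `-γ(r_#(α) • r_#(β))` and
`-γ(r_#(β) • r_#(α))`, so their difference is the commutator in `[[r, r]]`; the first terms make up
`r([α, β]_r, γ)`. -/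
theorem IsSMatrix.tensorEval_eq {r : 𝔤 ⊗[ℝ] 𝔤} (hr : IsSMatrix r) (α β γ : 𝔤 →ₗ[ℝ] ℝ) :
    tensorEval r (coLeftMul (tensorSharp r α) β) γ + tensorEval r β (coLeftMul (tensorSharp r α) γ) =
      tensorEval r (coLeftMul (tensorSharp r β) α) γ +
        tensorEval r α (coLeftMul (tensorSharp r β) γ) := by
  have h := hr.bracket_eq_zero α β γ
  -- By symmetry `r([α, β]_r, γ)` is `[α, β]_r` evaluated at `r_#(γ)`, where the difference defining
  -- `[α, β]_r` splits.
  rw [sBracket, dualBracket, map_sub, map_sub, apply_tensorSharp, hr.tensorEval_symm,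
    ← apply_tensorSharp, LinearMap.sub_apply, apply_tensorSharp, apply_tensorSharp,
    hr.tensorEval_symm γ, hr.tensorEval_symm γ] at h
  rw [tensorEval_coLeftMul, tensorEval_coLeftMul]
  linarith

/-- `-[[r, r]](α, β, γ)` expanded over pure tensors, arranged for the Jacobi identity: `u i` will be
lifted horizontally and `v i` vertically, with `α`, `β` vertical and `γ` horizontal derivatives. -/
theorem IsSMatrix.sum_eq_zero {ι : Type*} {s : Finset ι} {u v : ι → 𝔤}
    (hr : IsSMatrix (∑ i ∈ s, u i ⊗ₜ[ℝ] v i)) (α β γ : 𝔤 →ₗ[ℝ] ℝ) :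
    ∑ i ∈ s, ∑ j ∈ s, (α (v i) * β (u i * v j) * γ (u j) - β (v i) * α (u i * v j) * γ (u j) +
      α (v i) * β (v j) * γ (u i * u j - u j * u i)) = 0 := by
  have hsharp (α : 𝔤 →ₗ[ℝ] ℝ) :
      tensorSharp (∑ i ∈ s, u i ⊗ₜ[ℝ] v i) α = ∑ i ∈ s, α (v i) • u i := by
    -- Symmetry of `r` moves the contraction from the first factors to the second ones, so that
    -- covectors meet only the `v i`.
    conv_lhs => rw [← hr.symm, map_sum]
    simp only [TensorProduct.comm_tmul]
    exact tensorSharp_sum_tmul s v u α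
  have h := hr.bracket_eq_zero α β γ
  simp only [sBracket, dualBracket, hsharp, coLeftMul, map_sub, map_sum,
    LinearMap.sub_apply, LinearMap.neg_apply, LinearMap.comp_apply, LinearMap.mulLeft_apply,
    Finset.sum_mul, Finset.mul_sum, mul_smul_comm, smul_mul_assoc, map_smul, smul_eq_mul, sub_mul, neg_mul] at h
  simp only [Finset.sum_sub_distrib, Finset.sum_neg_distrib] at h
  simp only [map_sub, mul_sub, Finset.sum_add_distrib, Finset.sum_sub_distrib]
  -- The expansion of `h` has the summation indices in the other order; `e1` and `e2` exchange `i`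
  -- and `j`.
  have e1 (α β : 𝔤 →ₗ[ℝ] ℝ) :
      ∑ i ∈ s, ∑ j ∈ s, α (v i) * β (u i * v j) * γ (u j) =
        ∑ i ∈ s, ∑ j ∈ s, α (v j) * β (u j * v i) * γ (u i) := Finset.sum_comm
  have e2 : ∑ i ∈ s, ∑ j ∈ s, α (v i) * β (v j) * γ (u i * u j) =
      ∑ i ∈ s, ∑ j ∈ s, β (v i) * α (v j) * γ (u j * u i) := by
    rw [Finset.sum_comm]
    simp only [mul_comm (α _)]
  rw [e1, e1, e2]
  simp only [mul_assoc] at h ⊢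
  linarith

end SMatrixSums

/-! ### The Jacobi identity as an algebraic statement about 2-jets -/

section JacobiSums

variable {𝔤 : Type*} [LeftPreLieRing 𝔤] [LeftPreLieAlgebra ℝ 𝔤]

/-- The first and second derivatives of a function along vector fields `h x`, `v x` (`x ∈ 𝔤`) with
`[h x, h y] = h [x, y]`, `[h x, v y] = v (x * y)` and `[v x, v y] = 0`. -/
structure LiftJet (𝔤 : Type*) [LeftPreLieRing 𝔤] [LeftPreLieAlgebra ℝ 𝔤] where
  h : 𝔤 →ₗ[ℝ] ℝ
  v : 𝔤 →ₗ[ℝ] ℝ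
  -- In each second derivative the field of the second argument acts on the function first: `hv x y`
  -- stands for `h x (v y f)`.
  hh : 𝔤 → 𝔤 → ℝ
  hv : 𝔤 → 𝔤 → ℝ
  vh : 𝔤 → 𝔤 → ℝ
  vv : 𝔤 → 𝔤 → ℝ
  hh_sub : ∀ x y, hh x y - hh y x = h (x * y - y * x)
  hv_sub : ∀ x y, hv x y - vh y x = v (x * y)
  vv_comm : ∀ x y, vv x y = vv y x

namespace LiftJet

variable {ι : Type*} (s : Finset ι) (x y : ι → 𝔤)

/-- The iterated bracket `{F, {G, K}}`, where `{F, G} = ∑ᵢ (h xᵢ F) (v yᵢ G) - (v yᵢ F) (h xᵢ G)`. -/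
def doubleBracket (F G K : LiftJet 𝔤) : ℝ :=
  ∑ i ∈ s, (F.h (x i) * (∑ j ∈ s, (G.h (x j) * K.vv (y i) (y j) + K.v (y j) * G.vh (y i) (x j) -
      (G.v (y j) * K.vh (y i) (x j) + K.h (x j) * G.vv (y i) (y j)))) -
    F.v (y i) * (∑ j ∈ s, (G.h (x j) * K.hv (x i) (y j) + K.v (y j) * G.hh (x i) (x j) -
      (G.v (y j) * K.hh (x i) (x j) + K.h (x j) * G.hv (x i) (y j)))))

/-- The part of `{F, {G, K}}` that involves second derivatives of `G`. -/
def secondOrderPart (F K G : LiftJet 𝔤) : ℝ :=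
  ∑ i ∈ s, ∑ j ∈ s, (F.h (x i) * K.v (y j) * G.vh (y i) (x j) -
    F.h (x i) * K.h (x j) * G.vv (y i) (y j) - F.v (y i) * K.v (y j) * G.hh (x i) (x j) +
    F.v (y i) * K.h (x j) * G.hv (x i) (y j))

theorem doubleBracket_eq (F G K : LiftJet 𝔤) :
    doubleBracket s x y F G K = secondOrderPart s x y F K G - secondOrderPart s x y F G K := by
  simp only [doubleBracket, secondOrderPart, Finset.mul_sum, ← Finset.sum_sub_distrib]
  refine Finset.sum_congr rfl fun i _ ↦ Finset.sum_congr rfl fun j _ ↦ ?_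
  ring

/-- Exchanging `F` and `K`, and with them `i` and `j`, reverses the order of every second derivative
of `G`. The vertical-vertical terms cancel, and the others leave commutators, which are first
derivatives of `G`. -/
theorem secondOrderPart_sub (F K G : LiftJet 𝔤) :
    secondOrderPart s x y F K G - secondOrderPart s x y K F G =
      ∑ i ∈ s, ∑ j ∈ s, F.v (y i) * G.v (x i * y j) * K.h (x j) -
      ∑ i ∈ s, ∑ j ∈ s, K.v (y i) * G.v (x i * y j) * F.h (x j) -
      ∑ i ∈ s, ∑ j ∈ s, F.v (y i) * K.v (y j) * G.h (x i * x j - x j * x i) := by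
  have e1 : secondOrderPart s x y K F G = ∑ i ∈ s, ∑ j ∈ s,
      (K.h (x j) * F.v (y i) * G.vh (y j) (x i) -
    K.h (x j) * F.h (x i) * G.vv (y j) (y i) - K.v (y j) * F.v (y i) * G.hh (x j) (x i) +
    K.v (y j) * F.h (x i) * G.hv (x j) (y i)) := Finset.sum_comm
  have e2 : ∑ i ∈ s, ∑ j ∈ s, K.v (y i) * G.v (x i * y j) * F.h (x j) =
      ∑ i ∈ s, ∑ j ∈ s, K.v (y j) * G.v (x j * y i) * F.h (x i) := Finset.sum_comm
  rw [e1, e2, secondOrderPart]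
  simp only [← Finset.sum_sub_distrib]
  refine Finset.sum_congr rfl fun i _ ↦ Finset.sum_congr rfl fun j _ ↦ ?_
  rw [← G.hh_sub, ← G.hv_sub, ← G.hv_sub, G.vv_comm (y j)]
  ring

/-- The six second-order parts pair off by the function differentiated twice (`h1`, `h2`, `h3`).
Sorting the resulting nine sums by the function differentiated horizontally instead gives the three
S-matrix equations `k1`, `k2`, `k3`. -/
theorem jacobi {s : Finset ι} {x y : ι → 𝔤} (hr : IsSMatrix (∑ i ∈ s, x i ⊗ₜ[ℝ] y i))
    (F G K : LiftJet 𝔤) :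
    doubleBracket s x y F G K + doubleBracket s x y G K F + doubleBracket s x y K F G = 0 := by
  have h1 := secondOrderPart_sub s x y F K G
  have h2 := secondOrderPart_sub s x y G F K
  have h3 := secondOrderPart_sub s x y K G F
  have k1 := hr.sum_eq_zero F.v K.v G.h
  have k2 := hr.sum_eq_zero G.v F.v K.h
  have k3 := hr.sum_eq_zero K.v G.v F.h
  simp only [Finset.sum_add_distrib, Finset.sum_sub_distrib] at k1 k2 k3
  rw [doubleBracket_eq, doubleBracket_eq, doubleBracket_eq]
  linarith

end LiftJet

end JacobiSums

/-! ### Calculus in one chart: derivatives along vector fields and their commutators -/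

section VectorValuedDerivative

open Filter
open scoped Topology

variable {F : Type*} [NormedAddCommGroup F] [NormedSpace ℝ F]
  {K : Type*} [TopologicalSpace K] {J : ModelWithCorners ℝ F K}
  {N : Type*} [TopologicalSpace N] [ChartedSpace K N]
  {F₁ : Type*} [NormedAddCommGroup F₁] [NormedSpace ℝ F₁]
  {F₂ : Type*} [NormedAddCommGroup F₂] [NormedSpace ℝ F₂]
  {p : N}

theorem Filter.EventuallyEq.mvfderiv_eq {f g : N → F₁} (h : f =ᶠ[𝓝 p] g) (v : TangentSpace J p) :
    mvfderiv J f p v = mvfderiv J g p v :=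
  congrArg (fun L : F →L[ℝ] F₁ ↦ L v) (h.mfderiv_eq (I := J) (I' := 𝓘(ℝ, F₁)))

theorem mvfderiv_comp_differentiableAt {g : F₁ → F₂} {f : N → F₁}
    (hg : DifferentiableAt ℝ g (f p)) (hf : MDifferentiableAt J 𝓘(ℝ, F₁) f p)
    (v : TangentSpace J p) :
    mvfderiv J (fun q ↦ g (f q)) p v = fderiv ℝ g (f p) (mvfderiv J f p v) := by
  have h := mfderiv_comp_apply p hg.mdifferentiableAt hf v
  rw [mfderiv_eq_fderiv] at h
  exact h

theorem mvfderiv_comp_mfderiv_apply {G : Type*} [NormedAddCommGroup G] [NormedSpace ℝ G]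
    {H : Type*} [TopologicalSpace H] {J' : ModelWithCorners ℝ G H}
    {N' : Type*} [TopologicalSpace N'] [ChartedSpace H N'] {g : N' → F₁} {f : N → N'}
    (hg : MDifferentiableAt J' 𝓘(ℝ, F₁) g (f p)) (hf : MDifferentiableAt J J' f p)
    (v : TangentSpace J p) :
    mvfderiv J (fun q ↦ g (f q)) p v = mvfderiv J' g (f p) (mfderiv J J' f p v) :=
  mfderiv_comp_apply p hg hf v

theorem mvfderiv_prodMk {f : N → F₁} {g : N → F₂} (hf : MDifferentiableAt J 𝓘(ℝ, F₁) f p)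
    (hg : MDifferentiableAt J 𝓘(ℝ, F₂) g p) (v : TangentSpace J p) :
    mvfderiv J (fun q ↦ (f q, g q)) p v = (mvfderiv J f p v, mvfderiv J g p v) := by
  have h1 := mvfderiv_comp_differentiableAt (g := Prod.fst) differentiableAt_fst
    (hf.prodMk_space hg) v
  have h2 := mvfderiv_comp_differentiableAt (g := Prod.snd) differentiableAt_snd
    (hf.prodMk_space hg) v
  rw [fderiv_fst] at h1
  rw [fderiv_snd] at h2
  exact Prod.ext h1.symm h2.symm

theorem mvfderiv_clm_apply {c : N → F₁ →L[ℝ] F₂} {u : N → F₁}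
    (hc : MDifferentiableAt J 𝓘(ℝ, F₁ →L[ℝ] F₂) c p) (hu : MDifferentiableAt J 𝓘(ℝ, F₁) u p)
    (v : TangentSpace J p) :
    mvfderiv J (fun q ↦ c q (u q)) p v = c p (mvfderiv J u p v) + mvfderiv J c p v (u p) := by
  have hg : HasFDerivAt (fun z : (F₁ →L[ℝ] F₂) × F₁ ↦ z.1 z.2) _ (c p, u p) :=
    hasFDerivAt_fst.clm_apply hasFDerivAt_snd
  have h := mvfderiv_comp_differentiableAt (f := fun q ↦ (c q, u q)) hg.differentiableAt
    (hc.prodMk_space hu) v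
  rw [mvfderiv_prodMk hc hu, hg.fderiv] at h
  simpa using h

variable [IsManifold J ∞ N]

/-- The trivialization of the tangent bundle attached to a chart is the derivative of that chart, so
`mvfderiv` of the chart may serve as the coordinates of a tangent vector. -/
theorem mvfderiv_extChartAt_eq {q : N} (hq : q ∈ (chartAt K p).source) (v : TangentSpace J q) :
    mvfderiv J (extChartAt J p) q v =
      (trivializationAt F (fun x : N ↦ TangentSpace J x) p ⟨q, v⟩).2 := by
  have : IsManifold J 1 N := .of_le (n := ∞) (by simp)
  have h := TangentBundle.continuousLinearMapAt_trivializationAt (I := J) hq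
  have h2 := congrArg (fun L : F →L[ℝ] F ↦ L v) h
  refine Eq.trans h2.symm ?_
  exact Bundle.Trivialization.continuousLinearMapAt_apply_of_mem (R := ℝ) _ (by simpa using hq) v

/-- A vector field is smooth at `p` if and only if its coordinate expression in the chart at `p`
is. -/
theorem contMDiffAt_vectorField_iff {A : ∀ q : N, TangentSpace J q} :
    ContMDiffAt J J.tangent ∞ (fun q ↦ (⟨q, A q⟩ : TangentBundle J N)) p ↔
      ContMDiffAt J 𝓘(ℝ, F) ∞ (fun q ↦ mvfderiv J (extChartAt J p) q (A q)) p := by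
  refine (Bundle.contMDiffAt_section (IB := J) (F := F) (E := fun x : N ↦ TangentSpace J x) p).trans ?_
  refine Filter.EventuallyEq.contMDiffAt_iff ?_
  filter_upwards [chart_source_mem_nhds K p] with q hq
  exact (mvfderiv_extChartAt_eq hq _).symm

variable [J.Boundaryless]

theorem contDiffAt_comp_extChartAt_symm {f : N → F₁} (hf : ContMDiffAt J 𝓘(ℝ, F₁) ∞ f p) :
    ContDiffAt ℝ ∞ (f ∘ (extChartAt J p).symm) (extChartAt J p p) := by
  have := (contMDiffAt_iff.1 hf).2
  rw [J.range_eq_univ, contDiffWithinAt_univ] at this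
  exact this

/-- The chain rule for `f = (f ∘ φ⁻¹) ∘ φ`. It holds at all points near `p`, so it can be
differentiated again at `p`. -/
theorem eventually_mvfderiv_eq_fderiv {f : N → F₁} (hf : ContMDiffAt J 𝓘(ℝ, F₁) ∞ f p) :
    ∀ᶠ q in 𝓝 p, ∀ v : TangentSpace J q, mvfderiv J f q v =
      fderiv ℝ (f ∘ (extChartAt J p).symm) (extChartAt J p q) (mvfderiv J (extChartAt J p) q v) := by
  have hF := contDiffAt_comp_extChartAt_symm hf
  have hev : ∀ᶠ y in 𝓝 (extChartAt J p p),
      DifferentiableAt ℝ (f ∘ (extChartAt J p).symm) y := by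
    have h1 : ContDiffAt ℝ 1 (f ∘ (extChartAt J p).symm) (extChartAt J p p) := hF.of_le (by simp)
    filter_upwards [h1.eventually (by simp)] with y hy
    exact hy.differentiableAt (by simp)
  filter_upwards [(continuousAt_extChartAt (I := J) p).eventually hev,
    extChartAt_source_mem_nhds (I := J) p] with q hq hq' v
  have : IsManifold J 1 N := .of_le (n := ∞) (by simp)
  rw [← mvfderiv_comp_differentiableAt hq (mdifferentiableAt_extChartAt (by simpa using hq'))]
  refine Filter.EventuallyEq.mvfderiv_eq ?_ _
  filter_upwards [extChartAt_source_mem_nhds' hq'] with z hz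
  simp only [Function.comp_apply, (extChartAt J p).left_inv hz]

theorem ContMDiffAt.mvfderiv_apply {f : N → F₁} (hf : ContMDiffAt J 𝓘(ℝ, F₁) ∞ f p)
    {A : ∀ q : N, TangentSpace J q}
    (hA : ContMDiffAt J J.tangent ∞ (fun q ↦ (⟨q, A q⟩ : TangentBundle J N)) p) :
    ContMDiffAt J 𝓘(ℝ, F₁) ∞ (fun q ↦ mvfderiv J f q (A q)) p := by
  have h1 := ((contDiffAt_comp_extChartAt_symm hf).fderiv_right (m := ∞) (by simp)).contMDiffAt
  refine ContMDiffAt.congr_of_eventuallyEq ((h1.comp p (contMDiffAt_extChartAt (I := J)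
    (n := ∞))).clm_apply (contMDiffAt_vectorField_iff.1 hA)) ?_
  filter_upwards [eventually_mvfderiv_eq_fderiv hf] with q hq
  exact hq _

/-- If the commutator of `B` and `A` on the coordinate functions of the chart at `p` is given by the
tangent vector `C`, then it is given by `C` on every smooth function. -/
theorem mvfderiv_commutator {A B : ∀ q : N, TangentSpace J q} {C : TangentSpace J p}
    (hA : ContMDiffAt J J.tangent ∞ (fun q ↦ (⟨q, A q⟩ : TangentBundle J N)) p)
    (hB : ContMDiffAt J J.tangent ∞ (fun q ↦ (⟨q, B q⟩ : TangentBundle J N)) p)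
    (hC : mvfderiv J (extChartAt J p) p C =
      mvfderiv J (fun q ↦ mvfderiv J (extChartAt J p) q (A q)) p (B p) -
        mvfderiv J (fun q ↦ mvfderiv J (extChartAt J p) q (B q)) p (A p))
    {f : N → F₁} (hf : ContMDiffAt J 𝓘(ℝ, F₁) ∞ f p) :
    mvfderiv J f p C = mvfderiv J (fun q ↦ mvfderiv J f q (A q)) p (B p) -
      mvfderiv J (fun q ↦ mvfderiv J f q (B q)) p (A p) := by
  have hF := contDiffAt_comp_extChartAt_symm hf
  have hF1 := hF.fderiv_right (m := ∞) (by simp)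
  have hφ : MDifferentiableAt J 𝓘(ℝ, F) (extChartAt J p) p :=
    (contMDiffAt_extChartAt (I := J) (n := ∞)).mdifferentiableAt (by simp)
  have hdF : MDifferentiableAt J 𝓘(ℝ, F →L[ℝ] F₁)
      (fun q ↦ fderiv ℝ (f ∘ (extChartAt J p).symm) (extChartAt J p q)) p :=
    (hF1.contMDiffAt.comp p (contMDiffAt_extChartAt (I := J) (n := ∞))).mdifferentiableAt (by simp)
  -- `B(A f)` is `df` applied to the derivative of the coordinates of `A` along `B`, plus the
  -- Hessian of `f` in the chart at `(B, A)`.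
  have key {A B : ∀ q : N, TangentSpace J q}
      (hA : ContMDiffAt J J.tangent ∞ (fun q ↦ (⟨q, A q⟩ : TangentBundle J N)) p) :
      mvfderiv J (fun q ↦ mvfderiv J f q (A q)) p (B p) =
        fderiv ℝ (f ∘ (extChartAt J p).symm) (extChartAt J p p)
          (mvfderiv J (fun q ↦ mvfderiv J (extChartAt J p) q (A q)) p (B p)) +
        fderiv ℝ (fderiv ℝ (f ∘ (extChartAt J p).symm)) (extChartAt J p p)
          (mvfderiv J (extChartAt J p) p (B p)) (mvfderiv J (extChartAt J p) p (A p)) := by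
    rw [Filter.EventuallyEq.mvfderiv_eq
      ((eventually_mvfderiv_eq_fderiv hf).mono fun q hq ↦ hq (A q)),
      mvfderiv_clm_apply hdF ((contMDiffAt_vectorField_iff.1 hA).mdifferentiableAt (by simp)),
      mvfderiv_comp_differentiableAt (hF1.differentiableAt (by simp)) hφ]
  -- The two Hessian terms cancel by symmetry; what remains is `df` of the coordinate commutator,
  -- which is `C` by `hC`.
  have hsymm : IsSymmSndFDerivAt ℝ (f ∘ (extChartAt J p).symm) (extChartAt J p p) :=
    hF.isSymmSndFDerivAt (by
      simpa using WithTop.coe_le_coe.2 (le_top : (2 : ℕ∞) ≤ ⊤))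
  rw [key hA, key hB, hsymm.eq (mvfderiv J (extChartAt J p) p (B p)),
    (eventually_mvfderiv_eq_fderiv hf).self_of_nhds C, hC, map_sub]
  abel

end VectorValuedDerivative

/-! ### The Lie bracket in a chart -/

section LieBracket

open Filter
open scoped Topology

variable {F : Type*} [NormedAddCommGroup F] [NormedSpace ℝ F]
  {K : Type*} [TopologicalSpace K] {J : ModelWithCorners ℝ F K}
  {N : Type*} [TopologicalSpace N] [ChartedSpace K N] {p : N} [IsManifold J ∞ N] [J.Boundaryless]

theorem mpullbackWithin_extChartAt_symm_apply (V : ∀ q : N, TangentSpace J q) {q : N}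
    (hq : q ∈ (extChartAt J p).source) :
    VectorField.mpullbackWithin 𝓘(ℝ, F) J (extChartAt J p).symm V (Set.range J)
      (extChartAt J p q) = mvfderiv J (extChartAt J p) q (V q) := by
  have : IsManifold J 1 N := .of_le (n := ∞) (by simp)
  have hy := (extChartAt J p).map_source hq
  have h := ContinuousLinearMap.inverse_eq
    (mfderivWithin_extChartAt_symm_comp_mfderiv_extChartAt hy)
    (mfderiv_extChartAt_comp_mfderivWithin_extChartAt_symm hy)
  rw [VectorField.mpullbackWithin_apply, h]
  rw [(extChartAt J p).left_inv hq]
  rfl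

/-- `mlieBracket` is by definition the bracket `DA(B) - DB(A)` of the fields transported to the
model space, pulled back by the chart; applying the derivative of the chart undoes the pullback. -/
theorem mvfderiv_extChartAt_mlieBracket {A B : ∀ q : N, TangentSpace J q}
    (hA : ContMDiffAt J J.tangent ∞ (fun q ↦ (⟨q, A q⟩ : TangentBundle J N)) p)
    (hB : ContMDiffAt J J.tangent ∞ (fun q ↦ (⟨q, B q⟩ : TangentBundle J N)) p) :
    mvfderiv J (extChartAt J p) p (VectorField.mlieBracket J B A p) =
      mvfderiv J (fun q ↦ mvfderiv J (extChartAt J p) q (A q)) p (B p) -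
        mvfderiv J (fun q ↦ mvfderiv J (extChartAt J p) q (B q)) p (A p) := by
  have hev (V : ∀ q : N, TangentSpace J q) :
      VectorField.mpullbackWithin 𝓘(ℝ, F) J (extChartAt J p).symm V (Set.range J) =ᶠ[𝓝
        (extChartAt J p p)] (fun q ↦ mvfderiv J (extChartAt J p) q (V q)) ∘ (extChartAt J p).symm := by
    filter_upwards [extChartAt_target_mem_nhds (I := J) p] with z hz
    have h := mpullbackWithin_extChartAt_symm_apply V ((extChartAt J p).map_target hz)
    rw [(extChartAt J p).right_inv hz] at h
    exact h
  have hval (V : ∀ q : N, TangentSpace J q) :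
      VectorField.mpullbackWithin 𝓘(ℝ, F) J (extChartAt J p).symm V (Set.range J)
        (extChartAt J p p) = mvfderiv J (extChartAt J p) p (V p) :=
    mpullbackWithin_extChartAt_symm_apply V (mem_extChartAt_source p)
  have : IsManifold J 1 N := .of_le (n := ∞) (by simp)
  rw [(eventually_mvfderiv_eq_fderiv (contMDiffAt_vectorField_iff.1 hA)).self_of_nhds,
    (eventually_mvfderiv_eq_fderiv (contMDiffAt_vectorField_iff.1 hB)).self_of_nhds,
    ← hval A, ← hval B, ← (hev A).fderiv_eq, ← (hev B).fderiv_eq]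
  -- The definition takes the bracket within a set that involves `Set.range J`; without boundary
  -- this set is everything.
  have hbr (S : Set F) (hS : S = Set.univ) (A' B' : F → F) (y : F) :
      VectorField.lieBracketWithin ℝ B' A' S y =
        fderiv ℝ A' y (B' y) - fderiv ℝ B' y (A' y) := by
    rw [hS, VectorField.lieBracketWithin_univ]
    rfl
  have h : VectorField.mlieBracket J B A p =
      (mfderiv J 𝓘(ℝ, F) (extChartAt J p) p).inverse _ :=
    VectorField.mlieBracketWithin_apply
  exact ((isInvertible_mfderiv_extChartAt (mem_extChartAt_source p)).inverse_apply_eq.1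
    h.symm).symm.trans (hbr _ (by simp [J.range_eq_univ]) _ _ _)

end LieBracket

/-! ### The connection form and the curvature equation in a chart -/

section ConnectionForm

open Filter
open scoped Topology

variable {E : Type*} [NormedAddCommGroup E] [NormedSpace ℝ E]
  {M : Type*} [TopologicalSpace M] [ChartedSpace E M] [IsManifold 𝓘(ℝ, E) ∞ M]

/-- The local vector field with constant coordinates `c` in the chart at `x₀`. -/
def constSection (x₀ : M) (c : E) (y : M) : TangentSpace 𝓘(ℝ, E) y :=
  (trivializationAt E (fun z : M ↦ TangentSpace 𝓘(ℝ, E) z) x₀).symmL ℝ y c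

theorem mvfderiv_extChartAt_constSection {x₀ y : M} (hy : y ∈ (chartAt E x₀).source) (c : E) :
    mvfderiv 𝓘(ℝ, E) (extChartAt 𝓘(ℝ, E) x₀) y (constSection x₀ c y) = c := by
  rw [mvfderiv_extChartAt_eq hy, constSection, Bundle.Trivialization.symmL_apply _
    (by simpa using hy), Bundle.Trivialization.apply_mk_symm _ (by simpa using hy)]

theorem contMDiffAt_constSection {x₀ y : M} (hy : y ∈ (chartAt E x₀).source) (c : E) :
    ContMDiffAt 𝓘(ℝ, E) 𝓘(ℝ, E).tangent ∞
      (fun z ↦ (⟨z, constSection x₀ c z⟩ : TangentBundle 𝓘(ℝ, E) M)) y := by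
  refine (Bundle.Trivialization.contMDiffAt_section_iff (IB := 𝓘(ℝ, E))
    (trivializationAt E (fun z : M ↦ TangentSpace 𝓘(ℝ, E) z) x₀) (by simpa using hy)).2 ?_
  refine (contMDiffAt_const (c := c)).congr_of_eventuallyEq ?_
  filter_upwards [(chartAt E x₀).open_source.mem_nhds hy] with z hz
  exact (mvfderiv_extChartAt_eq hz _).symm.trans (mvfderiv_extChartAt_constSection hz c)

theorem mdifferentiableAt_constSection {x₀ y : M} (hy : y ∈ (chartAt E x₀).source) (c : E) :
    MDifferentiableAt 𝓘(ℝ, E) 𝓘(ℝ, E).tangent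
      (fun z ↦ (⟨z, constSection x₀ c z⟩ : TangentBundle 𝓘(ℝ, E) M)) y :=
  (contMDiffAt_constSection hy c).mdifferentiableAt (by simp)

theorem mdifferentiableAt_mvfderiv_extChartAt {x₀ y : M} (hy : y ∈ (chartAt E x₀).source)
    {V : ∀ z : M, TangentSpace 𝓘(ℝ, E) z}
    (hV : MDifferentiableAt 𝓘(ℝ, E) 𝓘(ℝ, E).tangent
      (fun z ↦ (⟨z, V z⟩ : TangentBundle 𝓘(ℝ, E) M)) y) :
    MDifferentiableAt 𝓘(ℝ, E) 𝓘(ℝ, E)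
      (fun z ↦ mvfderiv 𝓘(ℝ, E) (extChartAt 𝓘(ℝ, E) x₀) z (V z)) y := by
  refine MDifferentiableAt.congr_of_eventuallyEq
    ((Bundle.Trivialization.mdifferentiableAt_section_iff 𝓘(ℝ, E)
    (trivializationAt E (fun z : M ↦ TangentSpace 𝓘(ℝ, E) z) x₀) V (by simpa using hy)).1 hV) ?_
  filter_upwards [(chartAt E x₀).open_source.mem_nhds hy] with z hz
  exact mvfderiv_extChartAt_eq hz _

variable [FiniteDimensional ℝ E]

/-- Flatness is stated for global smooth fields, so local constant fields are cut off by a bump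
function; on a Hausdorff manifold the bump function is globally smooth. -/
theorem exists_smoothVectorField_eventuallyEq_constSection [T2Space M] (x₀ : M) (c : E) :
    ∃ Z : SmoothVectorField 𝓘(ℝ, E) M, ∀ᶠ y in 𝓝 x₀, Z y = constSection x₀ c y := by
  obtain ⟨f⟩ : Nonempty (SmoothBumpFunction 𝓘(ℝ, E) x₀) := inferInstance
  have hf : ContMDiff 𝓘(ℝ, E) 𝓘(ℝ, ℝ) ∞ f := f.contMDiff
  refine ⟨⟨fun y ↦ f y • constSection x₀ c y, ?_⟩, ?_⟩
  · exact ContMDiffOn.smul_section_of_tsupport hf.contMDiffOn (chartAt E x₀).open_source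
      f.tsupport_subset_chartAt_source
      fun y hy ↦ (contMDiffAt_constSection hy c).contMDiffWithinAt
  · filter_upwards [f.eventuallyEq_one] with y hy
    change f y • constSection x₀ c y = constSection x₀ c y
    rw [hy]
    simp

variable (nabla : CovariantDerivative 𝓘(ℝ, E) E (fun x : M ↦ TangentSpace 𝓘(ℝ, E) x))

/-- The connection form in the chart at `x₀`: `∇_v` of the section with constant coordinates `c`
has coordinates `connForm nabla x₀ y v c`. -/
def connForm (x₀ y : M) (v : TangentSpace 𝓘(ℝ, E) y) : E →L[ℝ] E :=
  ∑ i, ((Module.finBasis ℝ E).coord i).toContinuousLinearMap.smulRight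
    (mvfderiv 𝓘(ℝ, E) (extChartAt 𝓘(ℝ, E) x₀) y
      (nabla (constSection x₀ (Module.finBasis ℝ E i)) y v))

/-- The coordinates of `∇_v V`, minus the derivative of the coordinates of `V`, depend only on the
value of `V` at the point. -/
theorem tensorialAt_connection (x₀ : M) {y : M} (hy : y ∈ (chartAt E x₀).source)
    (v : TangentSpace 𝓘(ℝ, E) y) :
    TensorialAt 𝓘(ℝ, E) E
      (fun V : (∀ y : M, TangentSpace 𝓘(ℝ, E) y) ↦
        mvfderiv 𝓘(ℝ, E) (extChartAt 𝓘(ℝ, E) x₀) y (nabla V y v) -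
          mvfderiv 𝓘(ℝ, E) (fun z ↦ mvfderiv 𝓘(ℝ, E) (extChartAt 𝓘(ℝ, E) x₀) z (V z)) y v) y where
  smul {f V} hf hV := by
    have h : (fun z ↦ mvfderiv 𝓘(ℝ, E) (extChartAt 𝓘(ℝ, E) x₀) z ((f • V) z)) =
        f • fun z ↦ mvfderiv 𝓘(ℝ, E) (extChartAt 𝓘(ℝ, E) x₀) z (V z) := by
      ext z; simp
    -- The Leibniz terms `df(v) V` of `∇` and of the coordinate derivative are equal and cancel.
    simp only [h, mvfderiv_smul hf (mdifferentiableAt_mvfderiv_extChartAt hy hV),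
      nabla.isCovariantDerivativeOnUniv.leibniz hV hf]
    simp [smul_sub]
  add {V W} hV hW := by
    have h : (fun z ↦ mvfderiv 𝓘(ℝ, E) (extChartAt 𝓘(ℝ, E) x₀) z ((V + W) z)) =
        (fun z ↦ mvfderiv 𝓘(ℝ, E) (extChartAt 𝓘(ℝ, E) x₀) z (V z)) +
          fun z ↦ mvfderiv 𝓘(ℝ, E) (extChartAt 𝓘(ℝ, E) x₀) z (W z) := by
      ext z; simp
    simp only [h, mvfderiv_add (mdifferentiableAt_mvfderiv_extChartAt hy hV)
      (mdifferentiableAt_mvfderiv_extChartAt hy hW),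
      nabla.isCovariantDerivativeOnUniv.add hV hW]
    simp
    abel

theorem mvfderiv_mvfderiv_constSection {x₀ y : M} (hy : y ∈ (chartAt E x₀).source) (c : E)
    (v : TangentSpace 𝓘(ℝ, E) y) :
    mvfderiv 𝓘(ℝ, E) (fun z ↦ mvfderiv 𝓘(ℝ, E) (extChartAt 𝓘(ℝ, E) x₀) z
      (constSection x₀ c z)) y v = 0 := by
  have h : (fun z ↦ mvfderiv 𝓘(ℝ, E) (extChartAt 𝓘(ℝ, E) x₀) z (constSection x₀ c z)) =ᶠ[𝓝 y]
      fun _ ↦ c := by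
    filter_upwards [(chartAt E x₀).open_source.mem_nhds hy] with z hz
    exact mvfderiv_extChartAt_constSection hz c
  rw [h.mvfderiv_eq, mvfderiv_const]
  rfl

/-- The definition fixes the values on a basis; tensoriality of `∇` minus the coordinate derivative,
which kills constant sections, extends them linearly to every `c`. -/
theorem connForm_apply {x₀ y : M} (hy : y ∈ (chartAt E x₀).source) (v : TangentSpace 𝓘(ℝ, E) y)
    (c : E) : connForm nabla x₀ y v c =
      mvfderiv 𝓘(ℝ, E) (extChartAt 𝓘(ℝ, E) x₀) y (nabla (constSection x₀ c) y v) := by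
  have hc : constSection x₀ c = fun z ↦ ∑ i, (((Module.finBasis ℝ E).repr c i) •
      constSection x₀ (Module.finBasis ℝ E i)) z := by
    funext z
    conv_lhs => rw [← (Module.finBasis ℝ E).sum_repr c]
    rw [constSection, map_sum]
    refine Finset.sum_congr rfl fun i _ ↦ ?_
    rw [map_smul]
    rfl
  have h := (tensorialAt_connection nabla x₀ hy v).sum (s := Finset.univ)
    (fun i ↦ ((Module.finBasis ℝ E).repr c i) • constSection x₀ (Module.finBasis ℝ E i))
    fun i _ ↦ mdifferentiableAt_const.smul_section (mdifferentiableAt_constSection hy _)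
  rw [← hc, mvfderiv_mvfderiv_constSection hy, sub_zero] at h
  rw [h, connForm, sum_apply]
  refine Finset.sum_congr rfl fun i _ ↦ ?_
  have h2 := (tensorialAt_connection nabla x₀ hy v).smul (f := fun _ ↦ (Module.finBasis ℝ E).repr c i)
    mdifferentiableAt_const (mdifferentiableAt_constSection hy (Module.finBasis ℝ E i))
  rw [mvfderiv_mvfderiv_constSection hy, sub_zero] at h2
  exact h2.symm

/-- The covariant derivative in the chart at `x₀`. -/
theorem mvfderiv_extChartAt_nabla {x₀ y : M} (hy : y ∈ (chartAt E x₀).source)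
    (v : TangentSpace 𝓘(ℝ, E) y) {V : ∀ z : M, TangentSpace 𝓘(ℝ, E) z}
    (hV : MDifferentiableAt 𝓘(ℝ, E) 𝓘(ℝ, E).tangent
      (fun z ↦ (⟨z, V z⟩ : TangentBundle 𝓘(ℝ, E) M)) y) :
    mvfderiv 𝓘(ℝ, E) (extChartAt 𝓘(ℝ, E) x₀) y (nabla V y v) =
      mvfderiv 𝓘(ℝ, E) (fun z ↦ mvfderiv 𝓘(ℝ, E) (extChartAt 𝓘(ℝ, E) x₀) z (V z)) y v +
        connForm nabla x₀ y v (mvfderiv 𝓘(ℝ, E) (extChartAt 𝓘(ℝ, E) x₀) y (V y)) := by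
  have hval : V y = constSection x₀ (mvfderiv 𝓘(ℝ, E) (extChartAt 𝓘(ℝ, E) x₀) y (V y)) y := by
    rw [mvfderiv_extChartAt_eq hy, constSection, Bundle.Trivialization.symmL_apply _
      (by simpa using hy), Bundle.Trivialization.symm_apply_apply_mk _ (by simpa using hy)]
  have h := (tensorialAt_connection nabla x₀ hy v).pointwise hV
    (mdifferentiableAt_constSection hy _) hval
  rw [mvfderiv_mvfderiv_constSection hy, sub_zero, ← connForm_apply nabla hy] at h
  rw [← h]
  abel

variable {nabla}

/-- `∇_X Y` as a smooth vector field. -/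
def IsFlatConnection.covDeriv (hnabla : IsFlatConnection nabla)
    (X Y : SmoothVectorField 𝓘(ℝ, E) M) : SmoothVectorField 𝓘(ℝ, E) M :=
  ⟨fun x ↦ nabla Y x (X x), fun _ ↦ ((hnabla.smooth.contMDiff.contMDiff
    (Y.contMDiff.contMDiffOn (s := Set.univ))).contMDiffAt Filter.univ_mem).clm_bundle_apply
      X.contMDiff.contMDiffAt⟩

theorem nabla_eq_of_eventuallyEq_constSection {Z : SmoothVectorField 𝓘(ℝ, E) M} {x₀ : M} {c : E}
    (hZ : ∀ᶠ y in 𝓝 x₀, Z y = constSection x₀ c y) :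
    ∀ᶠ y in 𝓝 x₀, ∀ v : TangentSpace 𝓘(ℝ, E) y,
      mvfderiv 𝓘(ℝ, E) (extChartAt 𝓘(ℝ, E) x₀) y (nabla Z y v) = connForm nabla x₀ y v c := by
  filter_upwards [eventually_eventually_nhds.2 hZ, chart_source_mem_nhds E x₀] with y hy hy' v
  rw [connForm_apply nabla hy', nabla.isCovariantDerivativeOnUniv.congr_of_eventuallyEq
    Z.mdifferentiableAt (mdifferentiableAt_constSection hy' c) Filter.univ_mem hy]

variable [T2Space M]

/-- Near `x₀` each basis component of the form is the coordinate expression of `∇_X Z` for a global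
smooth field `Z`. -/
theorem IsFlatConnection.contMDiffAt_connForm (hnabla : IsFlatConnection nabla)
    (X : SmoothVectorField 𝓘(ℝ, E) M) (x₀ : M) :
    ContMDiffAt 𝓘(ℝ, E) 𝓘(ℝ, E →L[ℝ] E) ∞ (fun y ↦ connForm nabla x₀ y (X y)) x₀ := by
  have h (i) : ContMDiffAt 𝓘(ℝ, E) 𝓘(ℝ, E) ∞ (fun y ↦ mvfderiv 𝓘(ℝ, E) (extChartAt 𝓘(ℝ, E) x₀) y
      (nabla (constSection x₀ (Module.finBasis ℝ E i)) y (X y))) x₀ := by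
    obtain ⟨Z, hZ⟩ := exists_smoothVectorField_eventuallyEq_constSection x₀ (Module.finBasis ℝ E i)
    refine (contMDiffAt_vectorField_iff.1
      (hnabla.covDeriv X Z).contMDiff.contMDiffAt).congr_of_eventuallyEq ?_
    filter_upwards [nabla_eq_of_eventuallyEq_constSection (nabla := nabla) hZ,
      chart_source_mem_nhds E x₀] with y hy hy'
    rw [← connForm_apply nabla hy']
    exact (hy _).symm
  unfold connForm
  refine ContMDiffAt.sum fun i _ ↦ ?_
  exact (ContinuousLinearMap.smulRightL ℝ E E
    ((Module.finBasis ℝ E).coord i).toContinuousLinearMap).contMDiff.contMDiffAt.comp x₀ (h i)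

/-- The curvature equation in the chart at `x₀`. -/
theorem IsFlatConnection.connForm_mlieBracket (hnabla : IsFlatConnection nabla)
    (X Y : SmoothVectorField 𝓘(ℝ, E) M) (x₀ : M) (c : E) :
    connForm nabla x₀ x₀ (VectorField.mlieBracket 𝓘(ℝ, E) X Y x₀) c =
      mvfderiv 𝓘(ℝ, E) (fun y ↦ connForm nabla x₀ y (Y y)) x₀ (X x₀) c -
        mvfderiv 𝓘(ℝ, E) (fun y ↦ connForm nabla x₀ y (X y)) x₀ (Y x₀) c +
        (connForm nabla x₀ x₀ (X x₀) (connForm nabla x₀ x₀ (Y x₀) c) -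
          connForm nabla x₀ x₀ (Y x₀) (connForm nabla x₀ x₀ (X x₀) c)) := by
  obtain ⟨Z, hZ⟩ := exists_smoothVectorField_eventuallyEq_constSection x₀ c
  have hev := nabla_eq_of_eventuallyEq_constSection (nabla := nabla) hZ
  -- With `Z` constant `= c` near `x₀`, `∇_Y Z` has coordinates `Γ(Y)c`, so `∇_X ∇_Y Z` has
  -- coordinates `X(Γ(Y))c + Γ(X)Γ(Y)c`.
  have key (X Y : SmoothVectorField 𝓘(ℝ, E) M) :
      mvfderiv 𝓘(ℝ, E) (extChartAt 𝓘(ℝ, E) x₀) x₀ (nabla (fun y ↦ nabla Z y (Y y)) x₀ (X x₀)) =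
        mvfderiv 𝓘(ℝ, E) (fun y ↦ connForm nabla x₀ y (Y y)) x₀ (X x₀) c +
          connForm nabla x₀ x₀ (X x₀) (connForm nabla x₀ x₀ (Y x₀) c) := by
    rw [mvfderiv_extChartAt_nabla nabla (V := fun y ↦ nabla Z y (Y y)) (mem_chart_source E x₀) _
      (hnabla.covDeriv Y Z).mdifferentiableAt, hev.self_of_nhds,
      Filter.EventuallyEq.mvfderiv_eq (hev.mono fun y hy ↦ hy (Y y)),
      mvfderiv_clm_apply ((hnabla.contMDiffAt_connForm Y x₀).mdifferentiableAt (by simp))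
        mdifferentiableAt_const, mvfderiv_const]
    simp
  have h := congrArg (mvfderiv 𝓘(ℝ, E) (extChartAt 𝓘(ℝ, E) x₀) x₀)
    (hnabla.curvature_eq_zero X Y Z x₀)
  rw [map_sub, map_sub, map_zero, key, key, hev.self_of_nhds, sub_eq_zero] at h
  rw [← h]
  abel

end ConnectionForm

/-! ### Horizontal and vertical lifts in the charts of the tangent bundle, and their commutators -/

section LiftedVectorFields

open Filter
open scoped Topology

variable {E : Type*} [NormedAddCommGroup E] [NormedSpace ℝ E]
  {M : Type*} [TopologicalSpace M] [ChartedSpace E M] [IsManifold 𝓘(ℝ, E) ∞ M]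

/-- The fibre coordinate on `TM` in the chart at `x₀`. -/
def fibreCoordAt (x₀ : M) (q : TangentBundle 𝓘(ℝ, E) M) : E :=
  (trivializationAt E (fun z : M ↦ TangentSpace 𝓘(ℝ, E) z) x₀ q).2

theorem fibreCoordAt_eq {x₀ : M} {q : TangentBundle 𝓘(ℝ, E) M}
    (hq : q.proj ∈ (chartAt E x₀).source) :
    fibreCoordAt x₀ q = mvfderiv 𝓘(ℝ, E) (extChartAt 𝓘(ℝ, E) x₀) q.proj q.snd :=
  (mvfderiv_extChartAt_eq hq _).symm

theorem contMDiffAt_proj_tangentBundle (q : TangentBundle 𝓘(ℝ, E) M) :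
    ContMDiffAt 𝓘(ℝ, E).tangent 𝓘(ℝ, E) ∞ (fun q : TangentBundle 𝓘(ℝ, E) M ↦ q.proj) q :=
  Bundle.contMDiffAt_proj (fun z : M ↦ TangentSpace 𝓘(ℝ, E) z)

theorem contMDiffAt_fibreCoordAt {x₀ : M} {q : TangentBundle 𝓘(ℝ, E) M}
    (hq : q.proj ∈ (chartAt E x₀).source) :
    ContMDiffAt 𝓘(ℝ, E).tangent 𝓘(ℝ, E) ∞ (fibreCoordAt x₀) q :=
  ((Bundle.Trivialization.contMDiffAt_iff (e := trivializationAt E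
    (fun z : M ↦ TangentSpace 𝓘(ℝ, E) z) x₀) (IB := 𝓘(ℝ, E)) (IM := 𝓘(ℝ, E).tangent)
    (f := fun q : TangentBundle 𝓘(ℝ, E) M ↦ q) (x₀ := q)
    (by simpa [Bundle.Trivialization.mem_source] using hq)).1 contMDiffAt_id).2

theorem mdifferentiableAt_fibreCoordAt {x₀ : M} {q : TangentBundle 𝓘(ℝ, E) M}
    (hq : q.proj ∈ (chartAt E x₀).source) :
    MDifferentiableAt 𝓘(ℝ, E).tangent 𝓘(ℝ, E) (fibreCoordAt x₀) q :=
  (contMDiffAt_fibreCoordAt hq).mdifferentiableAt (by simp)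

theorem eventually_proj_mem_chart_source (p : TangentBundle 𝓘(ℝ, E) M) :
    ∀ᶠ q : TangentBundle 𝓘(ℝ, E) M in 𝓝 p, q.proj ∈ (chartAt E p.proj).source :=
  (contMDiffAt_proj_tangentBundle p).continuousAt.eventually (chart_source_mem_nhds E p.proj)

variable [FiniteDimensional ℝ E]

/-- On one fibre the coordinate is a linear map, namely the derivative of the base chart, and so
equals its own derivative. -/
theorem mvfderiv_fibreCoordAt_fibreInclusionDeriv {x₀ x : M} (hx : x ∈ (chartAt E x₀).source)
    (u : E) (w : TangentSpace 𝓘(ℝ, E) x) :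
    mvfderiv 𝓘(ℝ, E).tangent (fibreCoordAt x₀) (⟨x, u⟩ : TangentBundle 𝓘(ℝ, E) M)
      (fibreInclusionDeriv x u w) = mvfderiv 𝓘(ℝ, E) (extChartAt 𝓘(ℝ, E) x₀) x w := by
  have h := mvfderiv_comp_mfderiv_apply (J := 𝓘(ℝ, E)) (J' := 𝓘(ℝ, E).tangent)
    (g := fibreCoordAt x₀) (f := fun w : E ↦ (⟨x, w⟩ : TangentBundle 𝓘(ℝ, E) M)) (p := u)
    (mdifferentiableAt_fibreCoordAt (q := ⟨x, u⟩) hx) (mdifferentiableAt_fibreInclusion x u) w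
  refine h.symm.trans ?_
  let D : E →L[ℝ] E := mvfderiv 𝓘(ℝ, E) (extChartAt 𝓘(ℝ, E) x₀) x
  have h2 : (fun w : E ↦ fibreCoordAt x₀ (⟨x, w⟩ : TangentBundle 𝓘(ℝ, E) M)) = D := by
    funext w
    exact fibreCoordAt_eq (q := ⟨x, w⟩) hx
  have h3 : mfderiv 𝓘(ℝ, E) 𝓘(ℝ, E) D u = D := D.mfderiv_eq
  rw [h2]
  exact congrArg (fun L : E →L[ℝ] E ↦ L w) h3

theorem mvfderiv_fibreCoordAt_verticalLift {x₀ : M} {q : TangentBundle 𝓘(ℝ, E) M}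
    (hq : q.proj ∈ (chartAt E x₀).source) (w : TangentSpace 𝓘(ℝ, E) q.proj) :
    mvfderiv 𝓘(ℝ, E).tangent (fibreCoordAt x₀) q (verticalLift q w) =
      mvfderiv 𝓘(ℝ, E) (extChartAt 𝓘(ℝ, E) x₀) q.proj w :=
  mvfderiv_fibreCoordAt_fibreInclusionDeriv hq q.snd w

variable (nabla : CovariantDerivative 𝓘(ℝ, E) E (fun x : M ↦ TangentSpace 𝓘(ℝ, E) x))

theorem mvfderiv_fibreCoordAt_extendDeriv {x₀ : M} {q : TangentBundle 𝓘(ℝ, E) M}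
    (hq : q.proj ∈ (chartAt E x₀).source) (v : TangentSpace 𝓘(ℝ, E) q.proj) :
    mvfderiv 𝓘(ℝ, E).tangent (fibreCoordAt x₀) q (extendDeriv q v) =
      mvfderiv 𝓘(ℝ, E) (fun y ↦ mvfderiv 𝓘(ℝ, E) (extChartAt 𝓘(ℝ, E) x₀) y
        (FiberBundle.extend E q.snd y)) q.proj v := by
  obtain ⟨x, u⟩ := q
  have h3 : (⟨x, FiberBundle.extend E u x⟩ : TangentBundle 𝓘(ℝ, E) M) = ⟨x, u⟩ := by simp
  have h := mvfderiv_comp_mfderiv_apply (J := 𝓘(ℝ, E)) (J' := 𝓘(ℝ, E).tangent)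
    (g := fibreCoordAt x₀)
    (f := fun y : M ↦ (⟨y, FiberBundle.extend E u y⟩ : TangentBundle 𝓘(ℝ, E) M)) (p := x)
    (mdifferentiableAt_fibreCoordAt hq) (FiberBundle.mdifferentiableAt_extend _ _ u) v
  rw [h3] at h
  refine h.symm.trans (Filter.EventuallyEq.mvfderiv_eq ?_ v)
  filter_upwards [(chartAt E x₀).open_source.mem_nhds hq] with y hy
  exact fibreCoordAt_eq (q := ⟨y, _⟩) hy

/-- For the extension `Y` of `u`, the fibre component is `dY(v) - (dY(v) + Γ(v)u)`: the dependence
on the extension drops out. -/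
theorem mvfderiv_fibreCoordAt_horizontalLift {x₀ : M} {q : TangentBundle 𝓘(ℝ, E) M}
    (hq : q.proj ∈ (chartAt E x₀).source) (v : TangentSpace 𝓘(ℝ, E) q.proj) :
    mvfderiv 𝓘(ℝ, E).tangent (fibreCoordAt x₀) q (horizontalLift nabla q v) =
      -connForm nabla x₀ q.proj v (fibreCoordAt x₀ q) := by
  rw [horizontalLift, LinearMap.sub_apply, map_sub, LinearMap.comp_apply,
    mvfderiv_fibreCoordAt_verticalLift hq, mvfderiv_fibreCoordAt_extendDeriv hq]
  have h := mvfderiv_extChartAt_nabla nabla hq v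
    (FiberBundle.mdifferentiableAt_extend 𝓘(ℝ, E) E q.snd)
  rw [FiberBundle.extend_apply_self, ← fibreCoordAt_eq hq] at h
  erw [h]
  abel

/-- The chart of `TM` at `p` consists of the base chart composed with the projection and the fibre
coordinate. -/
theorem mvfderiv_extChartAt_tangentBundle (p : TangentBundle 𝓘(ℝ, E) M)
    {q : TangentBundle 𝓘(ℝ, E) M} (hq : q.proj ∈ (chartAt E p.proj).source)
    (w : TangentSpace 𝓘(ℝ, E).tangent q) :
    mvfderiv 𝓘(ℝ, E).tangent (extChartAt 𝓘(ℝ, E).tangent p) q w =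
      (mvfderiv 𝓘(ℝ, E) (extChartAt 𝓘(ℝ, E) p.proj) q.proj
        (mfderiv 𝓘(ℝ, E).tangent 𝓘(ℝ, E) (fun q : TangentBundle 𝓘(ℝ, E) M ↦ q.proj) q w),
      mvfderiv 𝓘(ℝ, E).tangent (fibreCoordAt p.proj) q w) := by
  have : IsManifold 𝓘(ℝ, E) 1 M := .of_le (n := ∞) (by simp)
  have h : (extChartAt 𝓘(ℝ, E).tangent p : TangentBundle 𝓘(ℝ, E) M → E × E) =
      fun q ↦ (extChartAt 𝓘(ℝ, E) p.proj q.proj, fibreCoordAt p.proj q) := by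
    funext q
    rw [FiberBundle.extChartAt]
    rfl
  have hφ : MDifferentiableAt 𝓘(ℝ, E) 𝓘(ℝ, E) (extChartAt 𝓘(ℝ, E) p.proj) q.proj :=
    mdifferentiableAt_extChartAt hq
  have hproj := (contMDiffAt_proj_tangentBundle q).mdifferentiableAt (by simp)
  rw [h, ← mvfderiv_comp_mfderiv_apply hφ hproj]
  exact mvfderiv_prodMk (hφ.comp q hproj) (mdifferentiableAt_fibreCoordAt hq) w

/-- The coordinates of the vertical lift of a vector field. -/
theorem mvfderiv_extChartAt_verticalLift (p : TangentBundle 𝓘(ℝ, E) M)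
    (X : ∀ x : M, TangentSpace 𝓘(ℝ, E) x) :
    (fun q : TangentBundle 𝓘(ℝ, E) M ↦ mvfderiv 𝓘(ℝ, E).tangent (extChartAt 𝓘(ℝ, E).tangent p) q
      (verticalLift q (X q.proj))) =ᶠ[𝓝 p] fun q ↦
        ((0 : E), mvfderiv 𝓘(ℝ, E) (extChartAt 𝓘(ℝ, E) p.proj) q.proj (X q.proj)) := by
  filter_upwards [eventually_proj_mem_chart_source p] with q hq
  rw [mvfderiv_extChartAt_tangentBundle p hq, mfderiv_proj_verticalLift, map_zero,
    mvfderiv_fibreCoordAt_verticalLift hq]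

/-- The coordinates of the horizontal lift of a vector field. -/
theorem mvfderiv_extChartAt_horizontalLift (p : TangentBundle 𝓘(ℝ, E) M)
    (X : ∀ x : M, TangentSpace 𝓘(ℝ, E) x) :
    (fun q : TangentBundle 𝓘(ℝ, E) M ↦ mvfderiv 𝓘(ℝ, E).tangent (extChartAt 𝓘(ℝ, E).tangent p) q
      (horizontalLift nabla q (X q.proj))) =ᶠ[𝓝 p] fun q ↦
        (mvfderiv 𝓘(ℝ, E) (extChartAt 𝓘(ℝ, E) p.proj) q.proj (X q.proj),
          -connForm nabla p.proj q.proj (X q.proj) (fibreCoordAt p.proj q)) := by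
  filter_upwards [eventually_proj_mem_chart_source p] with q hq
  rw [mvfderiv_extChartAt_tangentBundle p hq, mfderiv_proj_horizontalLift,
    mvfderiv_fibreCoordAt_horizontalLift nabla hq]

variable {nabla}

theorem contMDiffAt_coord_proj (X : SmoothVectorField 𝓘(ℝ, E) M) (p : TangentBundle 𝓘(ℝ, E) M) :
    ContMDiffAt 𝓘(ℝ, E).tangent 𝓘(ℝ, E) ∞ (fun q : TangentBundle 𝓘(ℝ, E) M ↦
      mvfderiv 𝓘(ℝ, E) (extChartAt 𝓘(ℝ, E) p.proj) q.proj (X q.proj)) p :=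
  (contMDiffAt_vectorField_iff.1 X.contMDiff.contMDiffAt).comp p (contMDiffAt_proj_tangentBundle p)

theorem mvfderiv_coord_proj (X : SmoothVectorField 𝓘(ℝ, E) M) (p : TangentBundle 𝓘(ℝ, E) M)
    (w : TangentSpace 𝓘(ℝ, E).tangent p) :
    mvfderiv 𝓘(ℝ, E).tangent (fun q : TangentBundle 𝓘(ℝ, E) M ↦
      mvfderiv 𝓘(ℝ, E) (extChartAt 𝓘(ℝ, E) p.proj) q.proj (X q.proj)) p w =
    mvfderiv 𝓘(ℝ, E) (fun x ↦ mvfderiv 𝓘(ℝ, E) (extChartAt 𝓘(ℝ, E) p.proj) x (X x)) p.proj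
      (mfderiv 𝓘(ℝ, E).tangent 𝓘(ℝ, E) (fun q : TangentBundle 𝓘(ℝ, E) M ↦ q.proj) p w) :=
  mvfderiv_comp_mfderiv_apply
    (g := fun x ↦ mvfderiv 𝓘(ℝ, E) (extChartAt 𝓘(ℝ, E) p.proj) x (X x))
    ((contMDiffAt_vectorField_iff.1 X.contMDiff.contMDiffAt).mdifferentiableAt (by simp))
    ((contMDiffAt_proj_tangentBundle p).mdifferentiableAt (by simp)) w

theorem contMDiffAt_verticalLift (X : SmoothVectorField 𝓘(ℝ, E) M)
    (p : TangentBundle 𝓘(ℝ, E) M) :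
    ContMDiffAt 𝓘(ℝ, E).tangent 𝓘(ℝ, E).tangent.tangent ∞ (fun q ↦
      (⟨q, verticalLift q (X q.proj)⟩ :
        TangentBundle 𝓘(ℝ, E).tangent (TangentBundle 𝓘(ℝ, E) M))) p := by
  refine contMDiffAt_vectorField_iff.2 ?_
  exact (contMDiffAt_const.prodMk_space (contMDiffAt_coord_proj X p)).congr_of_eventuallyEq
    (mvfderiv_extChartAt_verticalLift p X)

variable [T2Space M]

theorem IsFlatConnection.contMDiffAt_connForm_proj (hnabla : IsFlatConnection nabla)
    (X : SmoothVectorField 𝓘(ℝ, E) M) (p : TangentBundle 𝓘(ℝ, E) M) :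
    ContMDiffAt 𝓘(ℝ, E).tangent 𝓘(ℝ, E →L[ℝ] E) ∞
      (fun q : TangentBundle 𝓘(ℝ, E) M ↦ connForm nabla p.proj q.proj (X q.proj)) p :=
  (hnabla.contMDiffAt_connForm X p.proj).comp p (contMDiffAt_proj_tangentBundle p)

theorem IsFlatConnection.contMDiffAt_connForm_fibreCoordAt (hnabla : IsFlatConnection nabla)
    (X : SmoothVectorField 𝓘(ℝ, E) M) (p : TangentBundle 𝓘(ℝ, E) M) :
    ContMDiffAt 𝓘(ℝ, E).tangent 𝓘(ℝ, E) ∞ (fun q : TangentBundle 𝓘(ℝ, E) M ↦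
      -connForm nabla p.proj q.proj (X q.proj) (fibreCoordAt p.proj q)) p :=
  ((hnabla.contMDiffAt_connForm_proj X p).clm_apply
    (contMDiffAt_fibreCoordAt (mem_chart_source E p.proj))).neg

theorem IsFlatConnection.mvfderiv_connForm_fibreCoordAt (hnabla : IsFlatConnection nabla)
    (X : SmoothVectorField 𝓘(ℝ, E) M) (p : TangentBundle 𝓘(ℝ, E) M)
    (w : TangentSpace 𝓘(ℝ, E).tangent p) :
    mvfderiv 𝓘(ℝ, E).tangent (fun q : TangentBundle 𝓘(ℝ, E) M ↦
      -connForm nabla p.proj q.proj (X q.proj) (fibreCoordAt p.proj q)) p w =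
    -(connForm nabla p.proj p.proj (X p.proj)
        (mvfderiv 𝓘(ℝ, E).tangent (fibreCoordAt p.proj) p w) +
      mvfderiv 𝓘(ℝ, E) (fun x ↦ connForm nabla p.proj x (X x)) p.proj
        (mfderiv 𝓘(ℝ, E).tangent 𝓘(ℝ, E) (fun q : TangentBundle 𝓘(ℝ, E) M ↦ q.proj) p w)
        (fibreCoordAt p.proj p)) := by
  have h := mvfderiv_clm_apply
    ((hnabla.contMDiffAt_connForm_proj X p).mdifferentiableAt (by simp))
    (mdifferentiableAt_fibreCoordAt (mem_chart_source E p.proj)) w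
  rw [mvfderiv_fun_neg, neg_apply, h]
  congr 3
  exact mvfderiv_comp_mfderiv_apply (g := fun x ↦ connForm nabla p.proj x (X x))
    ((hnabla.contMDiffAt_connForm X p.proj).mdifferentiableAt (by simp))
    ((contMDiffAt_proj_tangentBundle p).mdifferentiableAt (by simp)) w

theorem IsFlatConnection.contMDiffAt_horizontalLift (hnabla : IsFlatConnection nabla)
    (X : SmoothVectorField 𝓘(ℝ, E) M) (p : TangentBundle 𝓘(ℝ, E) M) :
    ContMDiffAt 𝓘(ℝ, E).tangent 𝓘(ℝ, E).tangent.tangent ∞ (fun q ↦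
      (⟨q, horizontalLift nabla q (X q.proj)⟩ :
        TangentBundle 𝓘(ℝ, E).tangent (TangentBundle 𝓘(ℝ, E) M))) p := by
  refine contMDiffAt_vectorField_iff.2 ?_
  exact ((contMDiffAt_coord_proj X p).prodMk_space
    (hnabla.contMDiffAt_connForm_fibreCoordAt X p)).congr_of_eventuallyEq
    (mvfderiv_extChartAt_horizontalLift nabla p X)

/-- The derivative of the coordinates of a vertical lift. -/
theorem mvfderiv_mvfderiv_verticalLift (X : SmoothVectorField 𝓘(ℝ, E) M)
    (p : TangentBundle 𝓘(ℝ, E) M) (w : TangentSpace 𝓘(ℝ, E).tangent p) :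
    mvfderiv 𝓘(ℝ, E).tangent (fun q : TangentBundle 𝓘(ℝ, E) M ↦
      mvfderiv 𝓘(ℝ, E).tangent (extChartAt 𝓘(ℝ, E).tangent p) q (verticalLift q (X q.proj))) p w =
    (0, mvfderiv 𝓘(ℝ, E) (fun x ↦ mvfderiv 𝓘(ℝ, E) (extChartAt 𝓘(ℝ, E) p.proj) x (X x)) p.proj
      (mfderiv 𝓘(ℝ, E).tangent 𝓘(ℝ, E) (fun q : TangentBundle 𝓘(ℝ, E) M ↦ q.proj) p w)) := by
  rw [(mvfderiv_extChartAt_verticalLift p X).mvfderiv_eq, mvfderiv_prodMk mdifferentiableAt_const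
    ((contMDiffAt_coord_proj X p).mdifferentiableAt (by simp)), mvfderiv_coord_proj,
    mvfderiv_const, zero_apply]

/-- The derivative of the coordinates of a horizontal lift. -/
theorem IsFlatConnection.mvfderiv_mvfderiv_horizontalLift (hnabla : IsFlatConnection nabla)
    (X : SmoothVectorField 𝓘(ℝ, E) M) (p : TangentBundle 𝓘(ℝ, E) M)
    (w : TangentSpace 𝓘(ℝ, E).tangent p) :
    mvfderiv 𝓘(ℝ, E).tangent (fun q : TangentBundle 𝓘(ℝ, E) M ↦
      mvfderiv 𝓘(ℝ, E).tangent (extChartAt 𝓘(ℝ, E).tangent p) q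
        (horizontalLift nabla q (X q.proj))) p w =
    (mvfderiv 𝓘(ℝ, E) (fun x ↦ mvfderiv 𝓘(ℝ, E) (extChartAt 𝓘(ℝ, E) p.proj) x (X x)) p.proj
      (mfderiv 𝓘(ℝ, E).tangent 𝓘(ℝ, E) (fun q : TangentBundle 𝓘(ℝ, E) M ↦ q.proj) p w),
    -(connForm nabla p.proj p.proj (X p.proj)
        (mvfderiv 𝓘(ℝ, E).tangent (fibreCoordAt p.proj) p w) +
      mvfderiv 𝓘(ℝ, E) (fun x ↦ connForm nabla p.proj x (X x)) p.proj
        (mfderiv 𝓘(ℝ, E).tangent 𝓘(ℝ, E) (fun q : TangentBundle 𝓘(ℝ, E) M ↦ q.proj) p w)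
        (fibreCoordAt p.proj p))) := by
  rw [(mvfderiv_extChartAt_horizontalLift nabla p X).mvfderiv_eq, mvfderiv_prodMk
    ((contMDiffAt_coord_proj X p).mdifferentiableAt (by simp))
    ((hnabla.contMDiffAt_connForm_fibreCoordAt X p).mdifferentiableAt (by simp)),
    mvfderiv_coord_proj, hnabla.mvfderiv_connForm_fibreCoordAt]

variable {f : TangentBundle 𝓘(ℝ, E) M → ℝ} {p : TangentBundle 𝓘(ℝ, E) M}

/-- `[X^h, Y^h] = [X, Y]^h` -/
theorem IsFlatConnection.horizontalLift_commutator (hnabla : IsFlatConnection nabla)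
    (X Y : SmoothVectorField 𝓘(ℝ, E) M) (hf : ContMDiffAt 𝓘(ℝ, E).tangent 𝓘(ℝ, ℝ) ∞ f p) :
    mvfderiv 𝓘(ℝ, E).tangent (fun q ↦ mvfderiv 𝓘(ℝ, E).tangent f q
        (horizontalLift nabla q (Y q.proj))) p (horizontalLift nabla p (X p.proj)) -
      mvfderiv 𝓘(ℝ, E).tangent (fun q ↦ mvfderiv 𝓘(ℝ, E).tangent f q
        (horizontalLift nabla q (X q.proj))) p (horizontalLift nabla p (Y p.proj)) =
    mvfderiv 𝓘(ℝ, E).tangent f p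
      (horizontalLift nabla p (VectorField.mlieBracket 𝓘(ℝ, E) X Y p.proj)) := by
  refine (mvfderiv_commutator (hnabla.contMDiffAt_horizontalLift Y p)
    (hnabla.contMDiffAt_horizontalLift X p) ?_ hf).symm
  have hp := mem_chart_source E p.proj
  rw [hnabla.mvfderiv_mvfderiv_horizontalLift, hnabla.mvfderiv_mvfderiv_horizontalLift,
    mvfderiv_extChartAt_tangentBundle p hp, mfderiv_proj_horizontalLift,
    mfderiv_proj_horizontalLift, mfderiv_proj_horizontalLift,
    mvfderiv_fibreCoordAt_horizontalLift nabla hp, mvfderiv_fibreCoordAt_horizontalLift nabla hp,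
    mvfderiv_fibreCoordAt_horizontalLift nabla hp,
    mvfderiv_extChartAt_mlieBracket Y.contMDiff.contMDiffAt X.contMDiff.contMDiffAt,
    hnabla.connForm_mlieBracket, map_neg, map_neg, Prod.mk_sub_mk]
  -- The base components agree. In the fibre, what is left is the curvature equation for `Γ([X, Y])`
  -- applied to the fibre coordinate of `p`.
  congr 1
  abel

/-- `[X^h, Y^v] = (∇_X Y)^v` -/
theorem IsFlatConnection.horizontalLift_verticalLift_commutator (hnabla : IsFlatConnection nabla)
    (X Y : SmoothVectorField 𝓘(ℝ, E) M) (hf : ContMDiffAt 𝓘(ℝ, E).tangent 𝓘(ℝ, ℝ) ∞ f p) :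
    mvfderiv 𝓘(ℝ, E).tangent (fun q ↦ mvfderiv 𝓘(ℝ, E).tangent f q
        (verticalLift q (Y q.proj))) p (horizontalLift nabla p (X p.proj)) -
      mvfderiv 𝓘(ℝ, E).tangent (fun q ↦ mvfderiv 𝓘(ℝ, E).tangent f q
        (horizontalLift nabla q (X q.proj))) p (verticalLift p (Y p.proj)) =
    mvfderiv 𝓘(ℝ, E).tangent f p (verticalLift p (nabla Y p.proj (X p.proj))) := by
  refine (mvfderiv_commutator (contMDiffAt_verticalLift Y p)
    (hnabla.contMDiffAt_horizontalLift X p) ?_ hf).symm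
  have hp := mem_chart_source E p.proj
  rw [hnabla.mvfderiv_mvfderiv_horizontalLift, mvfderiv_mvfderiv_verticalLift,
    mvfderiv_extChartAt_tangentBundle p hp, mfderiv_proj_horizontalLift,
    mfderiv_proj_verticalLift, mfderiv_proj_verticalLift,
    mvfderiv_fibreCoordAt_verticalLift hp, mvfderiv_fibreCoordAt_verticalLift hp,
    mvfderiv_extChartAt_nabla nabla hp _ Y.mdifferentiableAt, Prod.mk_sub_mk]
  -- The base component is zero; the fibre component is `X(Y) + Γ(X)Y`, the coordinates of `∇_X Y`.
  simp

/-- `[X^v, Y^v] = 0` -/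
theorem verticalLift_commutator
    (X Y : SmoothVectorField 𝓘(ℝ, E) M) (hf : ContMDiffAt 𝓘(ℝ, E).tangent 𝓘(ℝ, ℝ) ∞ f p) :
    mvfderiv 𝓘(ℝ, E).tangent (fun q ↦ mvfderiv 𝓘(ℝ, E).tangent f q
        (verticalLift q (Y q.proj))) p (verticalLift p (X p.proj)) =
      mvfderiv 𝓘(ℝ, E).tangent (fun q ↦ mvfderiv 𝓘(ℝ, E).tangent f q
        (verticalLift q (X q.proj))) p (verticalLift p (Y p.proj)) := by
  refine sub_eq_zero.1 ((mvfderiv_commutator (C := 0) (contMDiffAt_verticalLift Y p)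
    (contMDiffAt_verticalLift X p) ?_ hf).symm.trans (map_zero _))
  rw [mvfderiv_mvfderiv_verticalLift, mvfderiv_mvfderiv_verticalLift,
    mfderiv_proj_verticalLift, mfderiv_proj_verticalLift, map_zero, map_zero, map_zero, sub_self]

end LiftedVectorFields

/-! ### Bilinearity of tensor evaluation -/

section TensorEvalLinear

variable {V : Type*} [AddCommGroup V] [Module ℝ V]

theorem tensorEval_add_left (t : V ⊗[ℝ] V) (α α' β : V →ₗ[ℝ] ℝ) :
    tensorEval t (α + α') β = tensorEval t α β + tensorEval t α' β := by
  simp [tensorEval, TensorProduct.map_add_left]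

theorem tensorEval_add_right (t : V ⊗[ℝ] V) (α β β' : V →ₗ[ℝ] ℝ) :
    tensorEval t α (β + β') = tensorEval t α β + tensorEval t α β' := by
  simp [tensorEval, TensorProduct.map_add_right]

theorem tensorEval_zero_left (t : V ⊗[ℝ] V) (β : V →ₗ[ℝ] ℝ) : tensorEval t 0 β = 0 := by
  simp [tensorEval]

theorem tensorEval_zero_right (t : V ⊗[ℝ] V) (α : V →ₗ[ℝ] ℝ) : tensorEval t α 0 = 0 := by
  simp [tensorEval]

end TensorEvalLinear

/-! ### The derivative of a finite sum -/

section SumRule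

variable {F : Type*} [NormedAddCommGroup F] [NormedSpace ℝ F]
  {K : Type*} [TopologicalSpace K] {J : ModelWithCorners ℝ F K}
  {N : Type*} [TopologicalSpace N] [ChartedSpace K N]
  {F₁ : Type*} [NormedAddCommGroup F₁] [NormedSpace ℝ F₁] {p : N}

theorem mdifferentiableAt_sum_and_mvfderiv_sum {ι : Type*} (s : Finset ι) {f : ι → N → F₁}
    (hf : ∀ i ∈ s, MDifferentiableAt J 𝓘(ℝ, F₁) (f i) p) (v : TangentSpace J p) :
    MDifferentiableAt J 𝓘(ℝ, F₁) (fun q ↦ ∑ i ∈ s, f i q) p ∧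
      mvfderiv J (fun q ↦ ∑ i ∈ s, f i q) p v = ∑ i ∈ s, mvfderiv J (f i) p v := by
  classical
  induction s using Finset.induction_on with
  | empty => simp [mdifferentiableAt_const, mvfderiv_const]
  | insert a s ha ih =>
    have ha' := hf a (Finset.mem_insert_self a s)
    obtain ⟨h1, h2⟩ := ih fun i hi ↦ hf i (Finset.mem_insert_of_mem hi)
    simp only [Finset.sum_insert ha]
    exact ⟨ha'.add h1, by rw [mvfderiv_fun_add ha' h1, add_apply, h2]⟩

theorem mvfderiv_sum {ι : Type*} (s : Finset ι) {f : ι → N → F₁}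
    (hf : ∀ i ∈ s, MDifferentiableAt J 𝓘(ℝ, F₁) (f i) p) (v : TangentSpace J p) :
    mvfderiv J (fun q ↦ ∑ i ∈ s, f i q) p v = ∑ i ∈ s, mvfderiv J (f i) p v :=
  (mdifferentiableAt_sum_and_mvfderiv_sum s hf v).2

end SumRule

/-! ### The associated bivector field and its uniqueness -/

section Association

variable {E : Type*} [NormedAddCommGroup E] [NormedSpace ℝ E] [FiniteDimensional ℝ E]
  {M : Type*} [TopologicalSpace M] [ChartedSpace E M] [IsManifold 𝓘(ℝ, E) ∞ M]
  {nabla : CovariantDerivative 𝓘(ℝ, E) E (fun x : M ↦ TangentSpace 𝓘(ℝ, E) x)}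
  {𝔤 : Type*} [AddCommGroup 𝔤] [Module ℝ 𝔤] {ρ : 𝔤 →ₗ[ℝ] SmoothVectorField 𝓘(ℝ, E) M}

theorem tensorEval_pushTensor (r : 𝔤 ⊗[ℝ] 𝔤) (x : M) (α β : TangentSpace 𝓘(ℝ, E) x →ₗ[ℝ] ℝ) :
    tensorEval (pushTensor ρ r x) α β = tensorEval r (α ∘ₗ evalAt ρ x) (β ∘ₗ evalAt ρ x) :=
  tensorEval_map _ _ _ _

theorem tensorEval_pushLiftTensor_doubleTensor (r : 𝔤 ⊗[ℝ] 𝔤) (p : TangentBundle 𝓘(ℝ, E) M)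
    (α β : TangentSpace 𝓘(ℝ, E).tangent p →ₗ[ℝ] ℝ) :
    tensorEval (pushLiftTensor nabla ρ (doubleTensor r) p) α β =
      tensorEval r (α ∘ₗ horizontalLift nabla p ∘ₗ evalAt ρ p.proj)
        (β ∘ₗ verticalLift p ∘ₗ evalAt ρ p.proj) -
      tensorEval r (β ∘ₗ horizontalLift nabla p ∘ₗ evalAt ρ p.proj)
        (α ∘ₗ verticalLift p ∘ₗ evalAt ρ p.proj) := by
  rw [pushLiftTensor, tensorEval_map, liftAt, LinearMap.comp_coprod, LinearMap.comp_coprod,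
    tensorEval_doubleTensor]

/-- Each term of `R` pairs one covector with horizontal and the other with vertical lifts; a lifted
covector vanishes on one kind and restricts to the original covector on the other. -/
theorem isAssociatedBivector_pushLiftTensor (r : 𝔤 ⊗[ℝ] 𝔤) :
    IsAssociatedBivector nabla (pushTensor ρ r) (pushLiftTensor nabla ρ (doubleTensor r)) := by
  intro p α β
  have hv (α) : verticalLiftForm nabla p α ∘ₗ verticalLift p ∘ₗ evalAt ρ p.proj =
      α ∘ₗ evalAt ρ p.proj := by
    ext u; exact (verticalLiftForm_apply nabla p α _).1
  have hv0 (α) : verticalLiftForm nabla p α ∘ₗ horizontalLift nabla p ∘ₗ evalAt ρ p.proj = 0 := by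
    ext u; exact (verticalLiftForm_apply nabla p α _).2
  have hh (α) : horizontalLiftForm nabla p α ∘ₗ horizontalLift nabla p ∘ₗ evalAt ρ p.proj =
      α ∘ₗ evalAt ρ p.proj := by
    ext u; exact (horizontalLiftForm_apply nabla p α _).1
  have hh0 (α) : horizontalLiftForm nabla p α ∘ₗ verticalLift p ∘ₗ evalAt ρ p.proj = 0 := by
    ext u; exact (horizontalLiftForm_apply nabla p α _).2
  simp only [tensorEval_pushLiftTensor_doubleTensor, tensorEval_pushTensor, hv, hv0, hh, hh0,
    tensorEval_zero_left, tensorEval_zero_right]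
  simp

theorem covector_eq_lifts (p : TangentBundle 𝓘(ℝ, E) M)
    (α : TangentSpace 𝓘(ℝ, E).tangent p →ₗ[ℝ] ℝ) :
    α = horizontalLiftForm nabla p (α ∘ₗ horizontalLift nabla p) +
      verticalLiftForm nabla p (α ∘ₗ verticalLift p) := by
  ext w
  obtain ⟨⟨a, b⟩, rfl⟩ := (splitting nabla p).surjective w
  simp [horizontalLiftForm, verticalLiftForm]
  simp [splitting]

theorem IsAssociatedBivector.unique {h : TwoTensorField 𝓘(ℝ, E) M}
    {P P' : TwoTensorField 𝓘(ℝ, E).tangent (TangentBundle 𝓘(ℝ, E) M)}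
    (hP : IsAssociatedBivector nabla h P) (hP' : IsAssociatedBivector nabla h P') : P = P' := by
  funext p
  have : FiniteDimensional ℝ (TangentSpace 𝓘(ℝ, E).tangent p) :=
    inferInstanceAs (FiniteDimensional ℝ (E × E))
  refine tensorEval_ext fun α β ↦ ?_
  rw [covector_eq_lifts (nabla := nabla) p α, covector_eq_lifts (nabla := nabla) p β]
  simp only [tensorEval_add_left, tensorEval_add_right]
  set α₁ := α ∘ₗ horizontalLift nabla p
  set α₂ := α ∘ₗ verticalLift p
  set β₁ := β ∘ₗ horizontalLift nabla p
  set β₂ := β ∘ₗ verticalLift p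
  rw [(hP p α₁ β₁).2.1, (hP' p α₁ β₁).2.1, (hP p α₁ β₂).2.2.1, (hP' p α₁ β₂).2.2.1,
    (hP p α₂ β₂).1, (hP' p α₂ β₂).1]
  -- The value on the vertical lift of `α₂` and the horizontal lift of `β₁` is prescribed only
  -- through its negative, with the roles of the two covectors exchanged.
  linarith [(hP p β₁ α₂).2.2.2, (hP' p β₁ α₂).2.2.2]

end Association

/-! ### The Codazzi equation for the image of an S-matrix -/

section PseudoHessian

variable {E : Type*} [NormedAddCommGroup E] [NormedSpace ℝ E] [FiniteDimensional ℝ E]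
  {M : Type*} [TopologicalSpace M] [ChartedSpace E M] [IsManifold 𝓘(ℝ, E) ∞ M]
  {nabla : CovariantDerivative 𝓘(ℝ, E) E (fun x : M ↦ TangentSpace 𝓘(ℝ, E) x)}
  {𝔤 : Type*} [LeftPreLieRing 𝔤] [LeftPreLieAlgebra ℝ 𝔤]
  {ρ : 𝔤 →ₗ[ℝ] SmoothVectorField 𝓘(ℝ, E) M}

theorem SmoothOneForm.contMDiff_apply {F : Type*} [NormedAddCommGroup F] [NormedSpace ℝ F]
    {K : Type*} [TopologicalSpace K] {J : ModelWithCorners ℝ F K}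
    {N : Type*} [TopologicalSpace N] [ChartedSpace K N] [IsManifold J ∞ N]
    (α : SmoothOneForm J N) {A : ∀ q : N, TangentSpace J q}
    (hA : ContMDiff J J.tangent ∞ (fun q ↦ (⟨q, A q⟩ : TangentBundle J N))) :
    ContMDiff J 𝓘(ℝ, ℝ) ∞ (fun q ↦ α q (A q)) := fun q ↦
  (Bundle.contMDiffAt_section (E := Bundle.Trivial N ℝ) q).1
    ((α.contMDiff q).clm_bundle_apply (E₂ := Bundle.Trivial N ℝ) (hA q))

theorem isSmooth_pushTensor (r : 𝔤 ⊗[ℝ] 𝔤) : (pushTensor ρ r).IsSmooth := by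
  intro α β
  obtain ⟨s, rfl⟩ := exists_sum_tmul r
  simp only [tensorEval_pushTensor, tensorEval_sum_tmul]
  refine ContMDiff.sum fun i _ ↦ ?_
  exact (α.contMDiff_apply (ρ i.1).contMDiff).mul (β.contMDiff_apply (ρ i.2).contMDiff)

theorem covDerivOneForm_apply (β : SmoothOneForm 𝓘(ℝ, E) M) (x : M) (v : TangentSpace 𝓘(ℝ, E) x)
    (Y : SmoothVectorField 𝓘(ℝ, E) M) :
    covDerivOneForm nabla β x v (Y x) =
      mvfderiv 𝓘(ℝ, E) (fun y ↦ β y (Y y)) x v - β x (nabla Y x v) :=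
  TensorialAt.mkHom_apply (tensorialAt_covDerivOneForm nabla β x v) Y.mdifferentiableAt

/-- On a pure tensor the Leibniz rule cancels the derivatives of `β(ρ u)` and `γ(ρ u)`, leaving
`β(∇_{ρ w} ρ u) = β(ρ(w • u))`, which is `-L*_w` applied to the pulled-back covector. -/
theorem covDerivTwoTensor_pushTensor
    (hρ : ∀ (u v : 𝔤) (x : M), ρ (u * v) x = nabla (ρ v) x (ρ u x))
    (r : 𝔤 ⊗[ℝ] 𝔤) (x : M) (w : 𝔤) (β γ : SmoothOneForm 𝓘(ℝ, E) M) :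
    covDerivTwoTensor nabla (pushTensor ρ r) x (ρ w x) β γ =
      -(tensorEval r (coLeftMul w ((β x).toLinearMap ∘ₗ evalAt ρ x))
          ((γ x).toLinearMap ∘ₗ evalAt ρ x) +
        tensorEval r ((β x).toLinearMap ∘ₗ evalAt ρ x)
          (coLeftMul w ((γ x).toLinearMap ∘ₗ evalAt ρ x))) := by
  obtain ⟨s, rfl⟩ := exists_sum_tmul r
  simp only [covDerivTwoTensor, tensorEval_pushTensor, tensorEval_sum_tmul]
  have hd (α : SmoothOneForm 𝓘(ℝ, E) M) (u : 𝔤) :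
      MDifferentiableAt 𝓘(ℝ, E) 𝓘(ℝ, ℝ) (fun y ↦ α y (ρ u y)) x :=
    (α.contMDiff_apply (ρ u).contMDiff).contMDiffAt.mdifferentiableAt (by simp)
  have hsum := mvfderiv_sum s (f := fun i y ↦ β y (ρ i.1 y) * γ y (ρ i.2 y))
    (fun i _ ↦ (hd β i.1).mul (hd γ i.2)) (ρ w x)
  have e (α : SmoothOneForm 𝓘(ℝ, E) M) (u : 𝔤) :
      covDerivOneForm nabla α x (ρ w x) (ρ u x) =
        mvfderiv 𝓘(ℝ, E) (fun y ↦ α y (ρ u y)) x (ρ w x) - α x (ρ (w * u) x) := by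
    rw [covDerivOneForm_apply, hρ]
  refine (congrArg₂ (· - ·) (congrArg₂ (· - ·) hsum rfl) rfl).trans ?_
  simp only [← Finset.sum_sub_distrib, ← Finset.sum_add_distrib, ← Finset.sum_neg_distrib]
  refine Finset.sum_congr rfl fun i _ ↦ ?_
  have hmul : mvfderiv 𝓘(ℝ, E) (fun y ↦ β y (ρ i.1 y) * γ y (ρ i.2 y)) x (ρ w x) = _ :=
    congrArg (fun L ↦ L (ρ w x)) (mvfderiv_mul (hd β i.1) (hd γ i.2))
  rw [hmul]
  change _ - covDerivOneForm nabla β x (ρ w x) (ρ i.1 x) * γ x (ρ i.2 x) -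
    β x (ρ i.1 x) * covDerivOneForm nabla γ x (ρ w x) (ρ i.2 x) =
      -(-(β x (ρ (w * i.1) x)) * γ x (ρ i.2 x) + β x (ρ i.1 x) * -(γ x (ρ (w * i.2) x)))
  rw [e, e]
  simp only [add_apply, smul_apply, smul_eq_mul]
  ring

theorem isContravariantPseudoHessian_pushTensor (hnabla : IsFlatConnection nabla)
    (hρ : ∀ (u v : 𝔤) (x : M), ρ (u * v) x = nabla (ρ v) x (ρ u x))
    {r : 𝔤 ⊗[ℝ] 𝔤} (hr : IsSMatrix r) :
    IsContravariantPseudoHessian nabla (pushTensor ρ r) where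
  flat := hnabla
  smooth := isSmooth_pushTensor r
  symm x := by rw [pushTensor, comm_map, hr.symm]
  codazzi α β γ x := by
    -- The direction of differentiation becomes `ρ(w)` at `x`, with `w` the contraction of `r` by
    -- the covector pulled back at `x`; this `w` may depend on `x`, since only the point value
    -- matters.
    have hsharp (α : SmoothOneForm 𝓘(ℝ, E) M) :
        tensorSharp (pushTensor ρ r x) (α x).toLinearMap =
          ρ (tensorSharp r ((α x).toLinearMap ∘ₗ evalAt ρ x)) x := tensorSharp_map _ _ _
    rw [hsharp, hsharp, covDerivTwoTensor_pushTensor hρ, covDerivTwoTensor_pushTensor hρ,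
      hr.tensorEval_eq]

end PseudoHessian

/-! ### The Poisson tensor on the tangent bundle -/

section Poisson

variable {E : Type*} [NormedAddCommGroup E] [NormedSpace ℝ E] [FiniteDimensional ℝ E]
  {M : Type*} [TopologicalSpace M] [T2Space M] [ChartedSpace E M] [IsManifold 𝓘(ℝ, E) ∞ M]
  {nabla : CovariantDerivative 𝓘(ℝ, E) E (fun x : M ↦ TangentSpace 𝓘(ℝ, E) x)}
  {𝔤 : Type*} [LeftPreLieRing 𝔤] [LeftPreLieAlgebra ℝ 𝔤]
  {ρ : 𝔤 →ₗ[ℝ] SmoothVectorField 𝓘(ℝ, E) M}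

theorem isSmooth_pushLiftTensor (hnabla : IsFlatConnection nabla) (r : 𝔤 ⊗[ℝ] 𝔤) :
    (pushLiftTensor nabla ρ (doubleTensor r)).IsSmooth := by
  intro α β
  obtain ⟨s, rfl⟩ := exists_sum_tmul r
  simp only [tensorEval_pushLiftTensor_doubleTensor, tensorEval_sum_tmul]
  refine ContMDiff.sub (ContMDiff.sum fun i _ ↦ ?_) (ContMDiff.sum fun i _ ↦ ?_)
  · exact (α.contMDiff_apply fun p ↦ hnabla.contMDiffAt_horizontalLift (ρ i.1) p).mul
      (β.contMDiff_apply fun p ↦ contMDiffAt_verticalLift (ρ i.2) p)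
  · exact (β.contMDiff_apply fun p ↦ hnabla.contMDiffAt_horizontalLift (ρ i.1) p).mul
      (α.contMDiff_apply fun p ↦ contMDiffAt_verticalLift (ρ i.2) p)

/-- Zero torsion makes `ρ` a morphism for the commutator bracket: `[X, Y] = ∇_X Y - ∇_Y X`. -/
theorem IsFlatConnection.mlieBracket_eq (hnabla : IsFlatConnection nabla)
    (hρ : ∀ (u v : 𝔤) (x : M), ρ (u * v) x = nabla (ρ v) x (ρ u x)) (u v : 𝔤) (x : M) :
    VectorField.mlieBracket 𝓘(ℝ, E) (ρ u) (ρ v) x = ρ (u * v - v * u) x := by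
  rw [← hnabla.torsion_eq_zero, map_sub, ContMDiffSection.coe_sub, Pi.sub_apply, hρ, hρ]

/-- The first and second derivatives at `p` of a function on `TM` along the horizontal and
vertical lifts of the vector fields `ρ u`. -/
def liftJet (hnabla : IsFlatConnection nabla)
    (hρ : ∀ (u v : 𝔤) (x : M), ρ (u * v) x = nabla (ρ v) x (ρ u x))
    (p : TangentBundle 𝓘(ℝ, E) M) {f : TangentBundle 𝓘(ℝ, E) M → ℝ}
    (hf : ContMDiff 𝓘(ℝ, E).tangent 𝓘(ℝ, ℝ) ∞ f) : LiftJet 𝔤 where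
  h := (mvfderiv 𝓘(ℝ, E).tangent f p).toLinearMap ∘ₗ horizontalLift nabla p ∘ₗ evalAt ρ p.proj
  v := (mvfderiv 𝓘(ℝ, E).tangent f p).toLinearMap ∘ₗ verticalLift p ∘ₗ evalAt ρ p.proj
  hh u v := mvfderiv 𝓘(ℝ, E).tangent (fun q ↦ mvfderiv 𝓘(ℝ, E).tangent f q
    (horizontalLift nabla q (ρ v q.proj))) p (horizontalLift nabla p (ρ u p.proj))
  hv u v := mvfderiv 𝓘(ℝ, E).tangent (fun q ↦ mvfderiv 𝓘(ℝ, E).tangent f q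
    (verticalLift q (ρ v q.proj))) p (horizontalLift nabla p (ρ u p.proj))
  vh u v := mvfderiv 𝓘(ℝ, E).tangent (fun q ↦ mvfderiv 𝓘(ℝ, E).tangent f q
    (horizontalLift nabla q (ρ v q.proj))) p (verticalLift p (ρ u p.proj))
  vv u v := mvfderiv 𝓘(ℝ, E).tangent (fun q ↦ mvfderiv 𝓘(ℝ, E).tangent f q
    (verticalLift q (ρ v q.proj))) p (verticalLift p (ρ u p.proj))
  hh_sub u v := by
    rw [hnabla.horizontalLift_commutator (ρ u) (ρ v) hf.contMDiffAt, hnabla.mlieBracket_eq hρ]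
    rfl
  hv_sub u v := by
    rw [hnabla.horizontalLift_verticalLift_commutator (ρ u) (ρ v) hf.contMDiffAt, ← hρ]
    rfl
  vv_comm u v := verticalLift_commutator (ρ u) (ρ v) hf.contMDiffAt

theorem bracket_pushLiftTensor (s : Finset (𝔤 × 𝔤)) (f g : TangentBundle 𝓘(ℝ, E) M → ℝ)
    (q : TangentBundle 𝓘(ℝ, E) M) :
    (pushLiftTensor nabla ρ (doubleTensor (∑ i ∈ s, i.1 ⊗ₜ[ℝ] i.2))).bracket f g q =
      ∑ i ∈ s, (mvfderiv 𝓘(ℝ, E).tangent f q (horizontalLift nabla q (ρ i.1 q.proj)) *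
          mvfderiv 𝓘(ℝ, E).tangent g q (verticalLift q (ρ i.2 q.proj)) -
        mvfderiv 𝓘(ℝ, E).tangent f q (verticalLift q (ρ i.2 q.proj)) *
          mvfderiv 𝓘(ℝ, E).tangent g q (horizontalLift nabla q (ρ i.1 q.proj))) := by
  rw [TwoTensorField.bracket, tensorEval_pushLiftTensor_doubleTensor, tensorEval_sum_tmul,
    tensorEval_sum_tmul, ← Finset.sum_sub_distrib]
  refine Finset.sum_congr rfl fun i _ ↦ ?_
  exact congrArg₂ (· - ·) rfl (mul_comm _ _)

/-- The Leibniz rule reduces the iterated bracket at `p` to first and second derivatives at `p`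
along lifted fields, after which only the jets of the three functions matter. -/
theorem bracket_bracket_pushLiftTensor (hnabla : IsFlatConnection nabla)
    (hρ : ∀ (u v : 𝔤) (x : M), ρ (u * v) x = nabla (ρ v) x (ρ u x))
    (s : Finset (𝔤 × 𝔤)) (p : TangentBundle 𝓘(ℝ, E) M)
    {f g k : TangentBundle 𝓘(ℝ, E) M → ℝ} (hf : ContMDiff 𝓘(ℝ, E).tangent 𝓘(ℝ, ℝ) ∞ f)
    (hg : ContMDiff 𝓘(ℝ, E).tangent 𝓘(ℝ, ℝ) ∞ g) (hk : ContMDiff 𝓘(ℝ, E).tangent 𝓘(ℝ, ℝ) ∞ k) :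
    (pushLiftTensor nabla ρ (doubleTensor (∑ i ∈ s, i.1 ⊗ₜ[ℝ] i.2))).bracket f
      ((pushLiftTensor nabla ρ (doubleTensor (∑ i ∈ s, i.1 ⊗ₜ[ℝ] i.2))).bracket g k) p =
    LiftJet.doubleBracket s Prod.fst Prod.snd (liftJet hnabla hρ p hf) (liftJet hnabla hρ p hg)
      (liftJet hnabla hρ p hk) := by
  have hH {f : TangentBundle 𝓘(ℝ, E) M → ℝ} (hf : ContMDiff 𝓘(ℝ, E).tangent 𝓘(ℝ, ℝ) ∞ f) (u : 𝔤) :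
      MDifferentiableAt 𝓘(ℝ, E).tangent 𝓘(ℝ, ℝ) (fun q ↦ mvfderiv 𝓘(ℝ, E).tangent f q
        (horizontalLift nabla q (ρ u q.proj))) p :=
    (hf.contMDiffAt.mvfderiv_apply
      (hnabla.contMDiffAt_horizontalLift (ρ u) p)).mdifferentiableAt (by simp)
  have hV {f : TangentBundle 𝓘(ℝ, E) M → ℝ} (hf : ContMDiff 𝓘(ℝ, E).tangent 𝓘(ℝ, ℝ) ∞ f) (u : 𝔤) :
      MDifferentiableAt 𝓘(ℝ, E).tangent 𝓘(ℝ, ℝ) (fun q ↦ mvfderiv 𝓘(ℝ, E).tangent f q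
        (verticalLift q (ρ u q.proj))) p :=
    (hf.contMDiffAt.mvfderiv_apply (contMDiffAt_verticalLift (ρ u) p)).mdifferentiableAt (by simp)
  rw [bracket_pushLiftTensor, LiftJet.doubleBracket]
  -- The inner bracket is differentiated in an arbitrary direction `w`, since the outer one uses
  -- both horizontal and vertical directions.
  have hD (w : TangentSpace 𝓘(ℝ, E).tangent p) :
      mvfderiv 𝓘(ℝ, E).tangent
        ((pushLiftTensor nabla ρ (doubleTensor (∑ i ∈ s, i.1 ⊗ₜ[ℝ] i.2))).bracket g k) p w =
      ∑ j ∈ s, (mvfderiv 𝓘(ℝ, E).tangent g p (horizontalLift nabla p (ρ j.1 p.proj)) *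
          mvfderiv 𝓘(ℝ, E).tangent (fun q ↦ mvfderiv 𝓘(ℝ, E).tangent k q
            (verticalLift q (ρ j.2 q.proj))) p w +
        mvfderiv 𝓘(ℝ, E).tangent k p (verticalLift p (ρ j.2 p.proj)) *
          mvfderiv 𝓘(ℝ, E).tangent (fun q ↦ mvfderiv 𝓘(ℝ, E).tangent g q
            (horizontalLift nabla q (ρ j.1 q.proj))) p w -
        (mvfderiv 𝓘(ℝ, E).tangent g p (verticalLift p (ρ j.2 p.proj)) *
          mvfderiv 𝓘(ℝ, E).tangent (fun q ↦ mvfderiv 𝓘(ℝ, E).tangent k q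
            (horizontalLift nabla q (ρ j.1 q.proj))) p w +
        mvfderiv 𝓘(ℝ, E).tangent k p (horizontalLift nabla p (ρ j.1 p.proj)) *
          mvfderiv 𝓘(ℝ, E).tangent (fun q ↦ mvfderiv 𝓘(ℝ, E).tangent g q
            (verticalLift q (ρ j.2 q.proj))) p w)) := by
    rw [funext (bracket_pushLiftTensor (nabla := nabla) (ρ := ρ) s g k)]
    refine (mvfderiv_sum s (fun i _ ↦
      ((hH hg i.1).mul (hV hk i.2)).sub ((hV hg i.2).mul (hH hk i.1))) w).trans ?_
    refine Finset.sum_congr rfl fun i _ ↦ ?_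
    rw [mvfderiv_sub ((hH hg i.1).mul (hV hk i.2)) ((hV hg i.2).mul (hH hk i.1)),
      mvfderiv_mul (hH hg i.1) (hV hk i.2), mvfderiv_mul (hV hg i.2) (hH hk i.1)]
    rfl
  refine Finset.sum_congr rfl fun i _ ↦ ?_
  rw [hD, hD]
  rfl

theorem isPoissonTensor_pushLiftTensor (hnabla : IsFlatConnection nabla)
    (hρ : ∀ (u v : 𝔤) (x : M), ρ (u * v) x = nabla (ρ v) x (ρ u x))
    {r : 𝔤 ⊗[ℝ] 𝔤} (hr : IsSMatrix r) :
    IsPoissonTensor (pushLiftTensor nabla ρ (doubleTensor r)) where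
  smooth := isSmooth_pushLiftTensor hnabla r
  skew p := by rw [pushLiftTensor, comm_map, comm_doubleTensor, map_neg]
  jacobi f g k hf hg hk p := by
    obtain ⟨s, rfl⟩ := exists_sum_tmul r
    rw [bracket_bracket_pushLiftTensor hnabla hρ s p hf hg hk,
      bracket_bracket_pushLiftTensor hnabla hρ s p hg hk hf,
      bracket_bracket_pushLiftTensor hnabla hρ s p hk hf hg]
    exact LiftJet.jacobi hr _ _ _

end Poisson

end

theorem mainTheorem9 {E : Type*} [NormedAddCommGroup E] [NormedSpace ℝ E] [FiniteDimensional ℝ E]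
    {M : Type*} [TopologicalSpace M] [T2Space M] [ChartedSpace E M] [IsManifold 𝓘(ℝ, E) ∞ M]
    (nabla : CovariantDerivative 𝓘(ℝ, E) E (fun x : M ↦ TangentSpace 𝓘(ℝ, E) x))
    (hnabla : IsFlatConnection nabla)
    {𝔤 : Type*} [LeftPreLieRing 𝔤] [LeftPreLieAlgebra ℝ 𝔤]
    (ρ : 𝔤 →ₗ[ℝ] SmoothVectorField 𝓘(ℝ, E) M)
    (hρ : ∀ (u v : 𝔤) (x : M), ρ (u * v) x = nabla (ρ v) x (ρ u x))
    (r : 𝔤 ⊗[ℝ] 𝔤) (hr : IsSMatrix r) :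
    (∀ P : TwoTensorField 𝓘(ℝ, E).tangent (TangentBundle 𝓘(ℝ, E) M),
      IsAssociatedBivector nabla (pushTensor ρ r) P ↔
        P = pushLiftTensor nabla ρ (doubleTensor r)) ∧
    IsPoissonTensor (pushLiftTensor nabla ρ (doubleTensor r)) ∧
    IsContravariantPseudoHessian nabla (pushTensor ρ r) := by
  refine ⟨fun P ↦ ⟨fun hP ↦ hP.unique (isAssociatedBivector_pushLiftTensor r), ?_⟩,
    isPoissonTensor_pushLiftTensor hnabla hρ hr,
    isContravariantPseudoHessian_pushTensor hnabla hρ hr⟩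
  rintro rfl
  exact isAssociatedBivector_pushLiftTensor r
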